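/- Let $d\ge 2$ be an integer, $0<\xi<\sqrt d/2$ and $\eta>0$. Consider planning a path of minimal Euclidean arc length in the obstacle-free cube $\mathcal X_{\rm free}=[0,1]^d$ from its center $x_{\rm init}=(\tfrac12,\dots,\tfrac12)$ to the goal region $\mathcal X_{\rm goal}=[0,1]^d\cap B(\vec 1;\xi)$, where $B(x;r)$ is the open Euclidean ball and $\vec 1=(1,\dots,1)$. A feasible path is a continuous curve $\sigma:[0,1]\to[0,1]^d$ of finite length with $\sigma(0)=x_{\rm init}$ and $\sigma(1)\in\mathrm{cl}(\mathcal X_{\rm goal})$; $c^*$ is the infimum of the lengths of feasible paths. The algorithm FMT* with $n$ samples and radius $r_n$ works on the set $V$ consisting of $x_{\rm init}$ and $n$ points drawn independently and uniformly from $[0,1]^d$; two points are neighbors if their distance is less than $r_n$. It starts with the tree consisting of the root $z=x_{\rm init}$, which is open, all other points of $V$ being unvisited. As long as $z\notin\mathcal X_{\rm goal}$, it does the following: for each unvisited neighbor $x$ of $z$, it chooses among the open neighbors $y$ of $x$ one that minimizes $c(y)+\|x-y\|$, where $c(y)$ is the length of the tree path from $x_{\rm init}$ to $y$, and, if the segment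 from $y$ to $x$ is collision-free, attaches $x$ to the tree by the edge $(y,x)$; then all newly attached points become open and $z$ becomes closed; if no open point is left, it reports failure, and otherwise the new $z$ is an open point with minimal $c(z)$. When $z\in\mathcal X_{\rm goal}$, it returns the tree path from $x_{\rm init}$ to $z$. Ties are broken arbitrarily. Let $c_n$ be the arc length of the returned path ($c_n=\infty$ in case of failure) for the radius $$r_n=(1+\eta)\,2\left(\frac1d\right)^{1/d}\left(\frac{\mu(\mathcal X_{\rm free})}{\zeta_d}\right)^{1/d}\left(\frac{\log n}{n}\right)^{1/d},$$ where $\mu$ is Lebesgue measure and $\zeta_d$ is the volume of the Euclidean unit ball of $\mathbb R^d$. Then a shortest feasible path exists, $c^*=\sqrt d/2-\xi$, and the minimal distance from a shortest path to the boundary of the cube (its clearance) is $\xi/\sqrt d$. Moreover, for every $\varepsilon>0$ and every $\rho>0$, as $n\to\infty$, $$\mathbb P\bigl(c_n>(1+\varepsilon)c^*\bigr)\in\begin{cases}O\!\left((\log n)^{-\frac1d}\,n^{\frac1d\left(1-(1+\eta)^d\right)+\rho}\right)&\text{if }\eta\le\frac{2}{(2^d-1)^{1/d}}-1,\\[1ex]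 O\!\left(n^{-\frac1d\left(\frac{1+\eta}{2}\right)^d+\rho}\right)&\text{if }\eta>\frac{2}{(2^d-1)^{1/d}}-1.\end{cases}$$ In particular, for $\eta=1$ the bound is $O(n^{-1/d+\rho})$. -/

import Mathlib

open MeasureTheory ProbabilityTheory Filter Asymptotics Set
open scoped ENNReal

noncomputable section

namespace FMT

/-! ### Path planning problems -/

/-- A path planning problem: obstacle-free space, initial state, goal region. -/
structure Problem (E : Type*) where
  free : Set E
  init : E
  goal : Set E

section Paths

variable {E : Type*} [PseudoMetricSpace E]

/-- Arc length (total variation) of a curve parametrized by `[0, 1]`. -/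
def arcLength (σ : unitInterval → E) : ℝ≥0∞ := eVariationOn σ Set.univ

/-- A path: a continuous curve of bounded variation. -/
def IsPath (σ : unitInterval → E) : Prop := Continuous σ ∧ arcLength σ ≠ ∞

/-- A feasible path: collision-free, from the initial state to the closure of the goal region. -/
def Feasible (P : Problem E) (σ : unitInterval → E) : Prop :=
  IsPath σ ∧ (∀ τ, σ τ ∈ P.free) ∧ σ 0 = P.init ∧ σ 1 ∈ closure P.goal

/-- The optimal cost `c*`: the infimum of the arc lengths of the feasible paths. -/
def optCost (P : Problem E) : ℝ≥0∞ := sInf (arcLength '' {σ | Feasible P σ})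

/-- A shortest path: a feasible path of minimal arc length. -/
def IsShortest (P : Problem E) (σ : unitInterval → E) : Prop :=
  Feasible P σ ∧ ∀ σ', Feasible P σ' → arcLength σ ≤ arcLength σ'

/-- `σ` has strong `δ`-clearance from the obstacle region `obs`. -/
def StrongClearance (obs : Set E) (δ : ℝ) (σ : unitInterval → E) : Prop :=
  0 < δ ∧ ∀ τ, ∀ p ∈ obs, δ ≤ dist (σ τ) p

end Paths

/-! ### The Fast Marching Tree algorithm -/

section Algorithm

variable {E : Type*} [NormedAddCommGroup E] [NormedSpace ℝ E]

/-- Arc length of the polygonal path through the given list of points. -/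
def polyLength : List E → ℝ
  | [] => 0
  | [_] => 0
  | x :: y :: l => ‖y - x‖ + polyLength (y :: l)

/-- State of the algorithm. The tree of paths is recorded through its branches: for a node `v` of
the tree, i.e. `v ∈ openSet ∪ closedSet`, the list `branch v` is the sequence of vertices of the
path from the root to `v` in the tree. (`branch v` is irrelevant for the other `v`.) -/
structure State (E : Type*) where
  z : E
  unvisited : Finset E
  openSet : Finset E
  closedSet : Finset E
  branch : E → List E

/-- Cost-to-arrive of a node of the tree: the length of its branch. -/
def State.cost (s : State E) (v : E) : ℝ := polyLength (s.branch v)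

open Classical in
/-- `Near(V, v, r)`: the elements of `V` at distance less than `r` from `v`. -/
def near (V : Finset E) (v : E) (r : ℝ) : Finset E := V.filter fun u => ‖u - v‖ < r

/-- The straight line from `u` to `v` stays in the obstacle-free space. -/
def CollisionFree (P : Problem E) (u v : E) : Prop := segment ℝ u v ⊆ P.free

/-- Initialization: only the initial state is open, all samples are unvisited. -/
def initState (P : Problem E) (V : Finset E) : State E :=
  open Classical in
  { z := P.init
    unvisited := V.erase P.init
    openSet := {P.init}
    closedSet := ∅
    branch := fun _ => [P.init] }

/-- The unvisited neighbors of the current node `z`. -/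
def State.xNear (s : State E) (V : Finset E) (r : ℝ) : Finset E :=
  open Classical in near (V.erase s.z) s.z r ∩ s.unvisited

/-- The open neighbors of `x`. -/
def State.yNear (s : State E) (V : Finset E) (r : ℝ) (x : E) : Finset E :=
  open Classical in near (V.erase x) x r ∩ s.openSet

/-- `ymin` is the choice, for every unvisited neighbor `x` of `z`, of an open neighbor `y` of `x`
minimizing `c(y) + Cost(y, x)`. -/
def State.IsArgmin (s : State E) (V : Finset E) (r : ℝ) (ymin : E → E) : Prop :=
  ∀ x ∈ s.xNear V r, ymin x ∈ s.yNear V r x ∧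
    ∀ y ∈ s.yNear V r x, s.cost (ymin x) + ‖x - ymin x‖ ≤ s.cost y + ‖x - y‖

/-- The unvisited neighbors of `z` that get connected to the tree. -/
def State.openNew (P : Problem E) (s : State E) (V : Finset E) (r : ℝ) (ymin : E → E) : Finset E :=
  open Classical in (s.xNear V r).filter fun x => CollisionFree P (ymin x) x

/-- The effect of one pass through the body of the main loop, before the next node `z` is chosen. -/
def State.update (P : Problem E) (s : State E) (V : Finset E) (r : ℝ) (ymin : E → E) : State E :=
  open Classical in
  { z := s.z
    unvisited := s.unvisited \ s.openNew P V r ymin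
    openSet := (s.openSet ∪ s.openNew P V r ymin).erase s.z
    closedSet := insert s.z s.closedSet
    branch := fun x =>
      if x ∈ s.openNew P V r ymin then s.branch (ymin x) ++ [x] else s.branch x }

/-- `Run P V r s o`: started in state `s` at the head of the main loop, the algorithm can terminate
with output `o`, which is the returned path (as a list of vertices), or `none` for failure.
Ties in the two minimizations can be broken in any way. -/
inductive Run (P : Problem E) (V : Finset E) (r : ℝ) : State E → Option (List E) → Prop
  | success {s : State E} (hz : s.z ∈ P.goal) : Run P V r s (some (s.branch s.z))
  | failure {s : State E} {ymin : E → E} (hz : s.z ∉ P.goal) (hy : s.IsArgmin V r ymin)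
      (hempty : (s.update P V r ymin).openSet = ∅) : Run P V r s none
  | step {s : State E} {ymin : E → E} {z' : E} {o : Option (List E)} (hz : s.z ∉ P.goal)
      (hy : s.IsArgmin V r ymin) (hmem : z' ∈ (s.update P V r ymin).openSet)
      (hmin : ∀ y ∈ (s.update P V r ymin).openSet,
        (s.update P V r ymin).cost z' ≤ (s.update P V r ymin).cost y)
      (hrun : Run P V r { s.update P V r ymin with z := z' } o) : Run P V r s o

/-- Arc length of the returned path, `∞` if failure is reported. -/
def outputCost : Option (List E) → ℝ≥0∞
  | none => ∞
  | some l => ENNReal.ofReal (polyLength l)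

/-- The node set: the initial state and the samples `x 0, …, x (n - 1)`. -/
def nodes (P : Problem E) {n : ℕ} (x : Fin n → E) : Finset E :=
  open Classical in insert P.init (Finset.univ.image x)

/-- `c` is the arc length of the path returned by the algorithm on the samples `x` with
connection radius `r` (for some way of breaking ties). -/
def IsCost (P : Problem E) {n : ℕ} (x : Fin n → E) (r : ℝ) (c : ℝ≥0∞) : Prop :=
  ∃ o, Run P (nodes P x) r (initState P (nodes P x)) o ∧ c = outputCost o

theorem exists_run (P : Problem E) (V : Finset E) (r : ℝ) (k : ℕ) (s : State E)
    (hk : s.unvisited.card + s.openSet.card ≤ k) (hz : s.z ∈ s.openSet)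
    (hV : s.openSet ⊆ V) (hU : s.unvisited ⊆ V) :
    ∃ o, Run P V r s o := by
  classical
  induction k generalizing s with
  | zero =>
    have : 0 < s.openSet.card := Finset.card_pos.2 ⟨_, hz⟩
    omega
  | succ k ih =>
    by_cases hg : s.z ∈ P.goal
    · exact ⟨_, .success hg⟩
    have hex : ∀ x, ∃ y, x ∈ s.xNear V r → y ∈ s.yNear V r x ∧
        ∀ y' ∈ s.yNear V r x, s.cost y + ‖x - y‖ ≤ s.cost y' + ‖x - y'‖ := by
      intro x
      by_cases hx : x ∈ s.xNear V r
      · have hne : (s.yNear V r x).Nonempty := by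
          refine ⟨s.z, ?_⟩
          simp only [State.xNear, State.yNear, near, Finset.mem_inter, Finset.mem_filter,
            Finset.mem_erase] at hx ⊢
          refine ⟨⟨⟨fun h => hx.1.1.1 h.symm, hV hz⟩, ?_⟩, hz⟩
          rw [norm_sub_rev]
          exact hx.1.2
        obtain ⟨y, hy, hy'⟩ := Finset.exists_min_image (s.yNear V r x)
          (fun y => s.cost y + ‖x - y‖) hne
        exact ⟨y, fun _ => ⟨hy, hy'⟩⟩
      · exact ⟨x, fun h => absurd h hx⟩
    choose ymin hymin using hex
    rcases Finset.eq_empty_or_nonempty (s.update P V r ymin).openSet with he | hne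
    · exact ⟨_, .failure hg hymin he⟩
    obtain ⟨z', hz', hmin⟩ := Finset.exists_min_image _ ((s.update P V r ymin).cost) hne
    have hnew : s.openNew P V r ymin ⊆ s.unvisited := fun x hx =>
      (Finset.mem_inter.1 (Finset.mem_filter.1 hx).1).2
    obtain ⟨o, ho⟩ := ih { s.update P V r ymin with z := z' } (by
        have h1 := Finset.card_sdiff_add_card_eq_card hnew
        have h2 := Finset.card_union_le s.openSet (s.openNew P V r ymin)
        have h3 := Finset.card_erase_of_mem
          (Finset.mem_union_left (s.openNew P V r ymin) hz)
        have h4 : 0 < s.openSet.card := Finset.card_pos.2 ⟨_, hz⟩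
        simp only [State.update]
        omega) hz'
        (fun x hx => by
          rcases Finset.mem_union.1 (Finset.mem_of_mem_erase hx) with h | h
          exacts [hV h, hU (hnew h)])
        (fun x hx => hU (Finset.mem_sdiff.1 hx).1)
    exact ⟨o, .step hg hymin hz' hmin ho⟩

/-- The algorithm terminates on every input. -/
theorem exists_isCost (P : Problem E) {n : ℕ} (x : Fin n → E) (r : ℝ) :
    ∃ c, IsCost P x r c := by
  classical
  obtain ⟨o, ho⟩ := exists_run P (nodes P x) r _ (initState P (nodes P x)) le_rfl
    (Finset.mem_singleton_self _)
    (Finset.singleton_subset_iff.2 (Finset.mem_insert_self _ _)) (Finset.erase_subset _ _)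
  exact ⟨_, o, ho, rfl⟩

end Algorithm

/-! ### The obstacle-free unit cube -/

/-- The cube `[0, 1] ^ d`. -/
def cube (d : ℕ) : Set (EuclideanSpace ℝ (Fin d)) := {x | ∀ i, x i ∈ Set.Icc (0 : ℝ) 1}

/-- The obstacle-free problem: from the center of the cube to the part of the cube in the ball of
radius `ξ` around the corner `(1, …, 1)`. -/
def cubeProblem (d : ℕ) (ξ : ℝ) : Problem (EuclideanSpace ℝ (Fin d)) where
  free := cube d
  init := WithLp.toLp 2 fun _ => 1 / 2
  goal := cube d ∩ Metric.ball (WithLp.toLp 2 fun _ => 1) ξ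

/-- The connection radius `r_n`. -/
def radius (d : ℕ) (free : Set (EuclideanSpace ℝ (Fin d))) (η : ℝ) (n : ℕ) : ℝ :=
  (1 + η) * 2 * (1 / (d : ℝ)) ^ (1 / (d : ℝ)) *
    (volume.real free / volume.real (Metric.ball (0 : EuclideanSpace ℝ (Fin d)) 1)) ^
      (1 / (d : ℝ)) *
    (Real.log n / n) ^ (1 / (d : ℝ))

end FMT

end

namespace FMT

/-! Without obstacles the algorithm behaves like Dijkstra's: its output is no longer than any walk
in the `r`-disk graph from the root to the goal (`Run.outputCost_le`). So it suffices to exhibit,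
with high probability, one short walk near the diagonal.

Place `M` centers along the diagonal at spacing `θ * s`, where `r = (2 + θ) * s`, the last one so
deep that its `s`-ball lies in the goal. If every `s`-ball contains a sample, consecutive samples
are neighbors. If moreover all but a fraction `θ * γ` of the concentric balls of radius `θ * γ * s`
contain a sample, the walk exceeds the length of the diagonal piece by a factor of at most `1 + 4 *
γ` (`exists_reach_of_balls`, `cost_le_of_balls`).

An empty `s`-ball is excluded by a union bound: `M` is of order `(n / log n) ^ (1 / d)`, and each
ball is empty with probability at most `n ^ (-q)`, where `q` tends to `(1 + η) ^ d / d` as `θ → 0`.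
Too many empty small balls are excluded by Markov's inequality for the number of `k`-subsets of
empty small balls. A fixed large `k` makes this term negligible (`measureReal_cost_gt_le`).

This proves the first bound for every `η > 0`; from the threshold on it implies the second. Optimal
cost and clearance come from the triangle inequality and its equality case. -/

theorem mem_nodes {E : Type*} (P : Problem E) {n : ℕ} (x : Fin n → E) (i : Fin n) :
    x i ∈ nodes P x := by
  simp [nodes]

/-! ### Optimality of the algorithm in the disk graph when there are no obstacles -/

section Algorithm

variable {E : Type*} [NormedAddCommGroup E]

/-- `Reach x₀ V r v L`: in the `r`-disk graph on `V` there is a walk of length `L` from `x₀`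
to `v`. -/
inductive Reach (x₀ : E) (V : Finset E) (r : ℝ) : E → ℝ → Prop
  | root : Reach x₀ V r x₀ 0
  | step {u v : E} {L : ℝ} (h : Reach x₀ V r u L) (hv : v ∈ V) (hr : ‖v - u‖ < r) :
      Reach x₀ V r v (L + ‖v - u‖)

theorem polyLength_append_singleton {l : List E} {y : E} (hl : l.getLast? = some y) (x : E) :
    polyLength (l ++ [x]) = polyLength l + ‖x - y‖ := by
  induction l with
  | nil => simp at hl
  | cons a l ih =>
    cases l with
    | nil =>
      simp only [List.getLast?_singleton, Option.some.injEq] at hl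
      subst hl
      simp [polyLength]
    | cons b l =>
      have := ih (by simpa using hl)
      simp only [List.cons_append, polyLength] at this ⊢
      rw [this]; ring

/-- The invariant of the main loop of the algorithm. -/
structure State.Inv (P : Problem E) (V : Finset E) (r : ℝ) (s : State E) : Prop where
  cover : ∀ v ∈ V, v ∈ s.unvisited ∨ v ∈ s.openSet ∨ v ∈ s.closedSet
  init_notMem : P.init ∉ s.unvisited
  unvisited_sub : s.unvisited ⊆ V
  open_sub : s.openSet ⊆ V
  open_disj : ∀ v ∈ s.openSet, v ∉ s.unvisited
  closed_nbr : ∀ u ∈ s.closedSet, ∀ v ∈ s.unvisited, r ≤ ‖v - u‖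
  closed_goal : ∀ u ∈ s.closedSet, u ∉ P.goal
  branch_last : ∀ v ∈ V, v ∉ s.unvisited → (s.branch v).getLast? = some v
  cost_le : ∀ v L, Reach P.init V r v L → v ∉ s.unvisited → s.cost v ≤ L

theorem Reach.mem {x₀ : E} {V : Finset E} {r : ℝ} {v : E} {L : ℝ} (h₀ : x₀ ∈ V)
    (h : Reach x₀ V r v L) : v ∈ V := by
  cases h <;> assumption

/-- The last visited vertex before the final unvisited stretch of the walk is not closed, because
closed nodes have no unvisited neighbors; so it is open. Its cost is at most the length of the walk
so far, and the triangle inequality replaces the rest by one segment. This segment may be longer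
than `r`. -/
theorem State.Inv.exists_open {P : Problem E} {V : Finset E} {r : ℝ} {s : State E}
    (h : s.Inv P V r) (h₀ : P.init ∈ V) {v : E} {L : ℝ} (hv : Reach P.init V r v L)
    (hu : v ∈ s.unvisited) : ∃ y ∈ s.openSet, s.cost y + ‖v - y‖ ≤ L := by
  induction hv with
  | root => exact absurd hu h.init_notMem
  | @step u v L hL hv hr ih =>
    by_cases hun : u ∈ s.unvisited
    · obtain ⟨y, hy, hle⟩ := ih hun
      refine ⟨y, hy, ?_⟩
      have := norm_sub_le_norm_sub_add_norm_sub v u y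
      linarith
    · rcases h.cover u (hL.mem h₀) with h1 | h1 | h1
      · exact absurd h1 hun
      · exact ⟨u, h1, by linarith [h.cost_le u L hL hun]⟩
      · exact absurd hr (not_lt.2 (h.closed_nbr u h1 v hu))

theorem inv_initState {P : Problem E} {V : Finset E} {r : ℝ} (h₀ : P.init ∈ V) :
    (initState P V).Inv P V r := by
  classical
  have key : ∀ v ∈ V, v ∉ V.erase P.init → v = P.init := fun v hv hn => by
    by_contra hne
    exact hn (Finset.mem_erase.2 ⟨hne, hv⟩)
  refine ⟨fun v hv => ?_, ?_, ?_, ?_, ?_, ?_, ?_, fun v hv hn => ?_, fun v L hL hn => ?_⟩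
  · by_cases hvi : v = P.init
    · right; left; simp [initState, hvi]
    · left; simp [initState, hvi, hv]
  · simp [initState]
  · exact Finset.erase_subset _ _
  · simpa [initState] using h₀
  · simp [initState]
  · simp [initState]
  · simp [initState]
  · have := key v hv (by simpa only [initState] using hn)
    simp [initState, this]
  · have hc : (initState P V).cost v = 0 := by simp [State.cost, initState, polyLength]
    rw [hc]
    clear hn hc
    induction hL with
    | root => exact le_rfl
    | step _ _ _ ih => positivity

variable [NormedSpace ℝ E]

/-- Since no segment is blocked, a pass attaches all unvisited neighbors of `z`, so closing `z`
preserves `closed_nbr`. The substance is `cost_le` for the newly attached nodes. -/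
theorem State.Inv.update {P : Problem E} {V : Finset E} {r : ℝ} {s : State E} {ymin : E → E}
    (h : s.Inv P V r) (h₀ : P.init ∈ V) (hfree : ∀ u ∈ V, ∀ v ∈ V, CollisionFree P u v)
    (hz : s.z ∈ s.openSet) (hmin : ∀ y ∈ s.openSet, s.cost s.z ≤ s.cost y)
    (hg : s.z ∉ P.goal) (hy : s.IsArgmin V r ymin) : (s.update P V r ymin).Inv P V r := by
  classical
  have hnear : ∀ x, x ∈ s.openNew P V r ymin ↔ x ∈ s.unvisited ∧ ‖x - s.z‖ < r := by
    intro x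
    constructor
    · intro hx
      simp only [openNew, xNear, near, Finset.mem_filter, Finset.mem_inter] at hx
      exact ⟨hx.1.2, hx.1.1.2⟩
    · rintro ⟨hx, hr⟩
      have hxn : x ∈ s.xNear V r := by
        simp only [xNear, near, Finset.mem_filter, Finset.mem_inter, Finset.mem_erase]
        exact ⟨⟨⟨fun he => h.open_disj _ hz (he ▸ hx), h.unvisited_sub hx⟩, hr⟩, hx⟩
      simp only [openNew, Finset.mem_filter]
      refine ⟨hxn, hfree _ ?_ _ (h.unvisited_sub hx)⟩
      have := (hy x hxn).1
      simp only [yNear, near, Finset.mem_filter, Finset.mem_inter] at this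
      exact h.open_sub this.2
  have hargmin : ∀ x ∈ s.openNew P V r ymin, ymin x ∈ s.openSet ∧
      ∀ y ∈ s.openSet, ‖y - x‖ < r → s.cost (ymin x) + ‖x - ymin x‖ ≤ s.cost y + ‖x - y‖ := by
    intro x hx
    have hxu := ((hnear x).1 hx).1
    have hxn : x ∈ s.xNear V r := (Finset.mem_filter.1 hx).1
    obtain ⟨h1, h2⟩ := hy x hxn
    refine ⟨(Finset.mem_inter.1 h1).2, fun y hyo hr => h2 y ?_⟩
    simp only [yNear, near, Finset.mem_filter, Finset.mem_inter, Finset.mem_erase]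
    exact ⟨⟨⟨fun he => h.open_disj _ hyo (he ▸ hxu), h.open_sub hyo⟩, hr⟩, hyo⟩
  have hbr : ∀ x ∈ s.openNew P V r ymin,
      (s.update P V r ymin).branch x = s.branch (ymin x) ++ [x] := by
    intro x hx; simp [State.update, hx]
  have hbr' : ∀ x ∉ s.openNew P V r ymin, (s.update P V r ymin).branch x = s.branch x := by
    intro x hx; simp [State.update, hx]
  have hunv : ∀ x, x ∈ (s.update P V r ymin).unvisited ↔
      x ∈ s.unvisited ∧ x ∉ s.openNew P V r ymin := by
    intro x; simp [State.update]
  have hopen : ∀ x, x ∈ (s.update P V r ymin).openSet ↔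
      x ≠ s.z ∧ (x ∈ s.openSet ∨ x ∈ s.openNew P V r ymin) := by
    intro x; simp [State.update]
  have hclosed : ∀ x, x ∈ (s.update P V r ymin).closedSet ↔ x = s.z ∨ x ∈ s.closedSet := by
    intro x; simp [State.update]
  refine ⟨fun v hv => ?_, fun hi => ?_, fun v hv => ?_, fun v hv => ?_, fun v hv hv' => ?_,
    fun u hu v hv => ?_, fun u hu => ?_, fun v hv hn => ?_, fun v L hL hn => ?_⟩
  · rw [hunv, hopen, hclosed]
    have := h.cover v hv
    tauto
  · exact h.init_notMem ((hunv _).1 hi).1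
  · exact h.unvisited_sub ((hunv _).1 hv).1
  · rcases ((hopen v).1 hv).2 with h1 | h1
    · exact h.open_sub h1
    · exact h.unvisited_sub ((hnear v).1 h1).1
  · rw [hunv] at hv'
    rcases ((hopen v).1 hv).2 with h1 | h1
    · exact h.open_disj v h1 hv'.1
    · exact hv'.2 h1
  · rw [hunv, hnear] at hv
    rcases (hclosed u).1 hu with rfl | h1
    · exact not_lt.1 fun hlt => hv.2 ⟨hv.1, hlt⟩
    · exact h.closed_nbr u h1 v hv.1
  · rcases (hclosed u).1 hu with rfl | h1
    · exact hg
    · exact h.closed_goal u h1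
  · by_cases hx : v ∈ s.openNew P V r ymin
    · rw [hbr v hx]; simp
    · rw [hbr' v hx]
      exact h.branch_last v hv fun hu => hn ((hunv v).2 ⟨hu, hx⟩)
  · by_cases hx : v ∈ s.openNew P V r ymin
    · obtain ⟨hyo, hym⟩ := hargmin v hx
      have hlast := h.branch_last _ (h.open_sub hyo) (h.open_disj _ hyo)
      have hcost : (s.update P V r ymin).cost v = s.cost (ymin v) + ‖v - ymin v‖ := by
        rw [State.cost, hbr v hx, polyLength_append_singleton hlast, State.cost]
      rw [hcost]
      obtain ⟨hvu, hvr⟩ := (hnear v).1 hx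
      obtain ⟨y, hyopen, hyle⟩ := h.exists_open h₀ hL hvu
      -- If `y` is a neighbor of `v`, it competes in the minimization. Otherwise `z` does at least
      -- as well: it has minimal cost and is closer to `v` than `r`, while `y` is not.
      by_cases hr : ‖y - v‖ < r
      · exact (hym y hyopen hr).trans hyle
      · have h1 := hym s.z hz (by rwa [norm_sub_rev])
        have h2 := hmin y hyopen
        rw [norm_sub_rev y v] at hr
        linarith
    · have : (s.update P V r ymin).cost v = s.cost v := by
        rw [State.cost, hbr' v hx, State.cost]
      rw [this]
      exact h.cost_le v L hL fun hu => hn ((hunv v).2 ⟨hu, hx⟩)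

/-- In the absence of obstacles, the algorithm finds a shortest path of the disk graph. -/
theorem Run.outputCost_le {P : Problem E} {V : Finset E} {r : ℝ} {s : State E}
    {o : Option (List E)} (hrun : Run P V r s o) (h₀ : P.init ∈ V)
    (hfree : ∀ u ∈ V, ∀ v ∈ V, CollisionFree P u v) (h : s.Inv P V r)
    (hz : s.z ∈ s.openSet) (hmin : ∀ y ∈ s.openSet, s.cost s.z ≤ s.cost y)
    {v : E} {L : ℝ} (hL : Reach P.init V r v L) (hv : v ∈ P.goal) :
    outputCost o ≤ ENNReal.ofReal L := by
  induction hrun with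
  | @success s hg =>
    refine ENNReal.ofReal_le_ofReal ?_
    change s.cost s.z ≤ L
    rcases h.cover v (hL.mem h₀) with h1 | h1 | h1
    · obtain ⟨y, hy, hle⟩ := h.exists_open h₀ hL h1
      linarith [hmin y hy, norm_nonneg (v - y)]
    · exact (hmin v h1).trans (h.cost_le v L hL (h.open_disj v h1))
    · exact absurd hv (h.closed_goal v h1)
  | @failure s ymin hg hy hempty =>
    exfalso
    have hu := h.update h₀ hfree hz hmin hg hy
    rcases hu.cover v (hL.mem h₀) with h1 | h1 | h1
    · obtain ⟨y, hy, -⟩ := hu.exists_open h₀ hL h1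
      simp [hempty] at hy
    · simp [hempty] at h1
    · exact absurd hv (hu.closed_goal v h1)
  | @step s ymin z' o hg hy hmem hmin' hrun ih =>
    have hu := h.update h₀ hfree hz hmin hg hy
    -- No field of the invariant mentions the current node, so it survives the choice of `z'`.
    exact ih ⟨hu.1, hu.2, hu.3, hu.4, hu.5, hu.6, hu.7, hu.8, hu.9⟩ hmem hmin'

theorem IsCost.le_of_reach {P : Problem E} {n : ℕ} {x : Fin n → E} {r : ℝ} {c : ℝ≥0∞}
    (hc : IsCost P x r c) (hconv : Convex ℝ P.free) (hinit : P.init ∈ P.free)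
    (hx : ∀ i, x i ∈ P.free) {v : E} {L : ℝ} (hL : Reach P.init (nodes P x) r v L)
    (hv : v ∈ P.goal) : c ≤ ENNReal.ofReal L := by
  classical
  obtain ⟨o, ho, rfl⟩ := hc
  have h₀ : P.init ∈ nodes P x := Finset.mem_insert_self _ _
  have hsub : ∀ u ∈ nodes P x, u ∈ P.free := by
    intro u hu
    rcases Finset.mem_insert.1 hu with rfl | hu
    · exact hinit
    · obtain ⟨i, -, rfl⟩ := Finset.mem_image.1 hu
      exact hx i
  refine ho.outputCost_le h₀ (fun u hu v hv => hconv.segment_subset (hsub u hu) (hsub v hv))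
    (inv_initState h₀) (Finset.mem_singleton_self _) (fun y hy => ?_) hL hv
  rw [Finset.mem_singleton.1 hy]
  exact le_rfl

end Algorithm

/-! ### The cube, its diagonal and its boundary -/

/-- The point `(t, …, t)`. -/
def diag (d : ℕ) (t : ℝ) : EuclideanSpace ℝ (Fin d) := WithLp.toLp 2 fun _ => t

@[simp] theorem diag_apply (d : ℕ) (t : ℝ) (i : Fin d) : diag d t i = t := rfl

theorem dist_diag (d : ℕ) (a b : ℝ) : dist (diag d a) (diag d b) = √(d : ℝ) * |a - b| := by
  rw [EuclideanSpace.dist_eq]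
  simp [Real.dist_eq, Real.sqrt_sq_eq_abs]

theorem abs_apply_sub_le {d : ℕ} (x y : EuclideanSpace ℝ (Fin d)) (i : Fin d) :
    |x i - y i| ≤ dist x y := by
  rw [dist_eq_norm]
  exact PiLp.norm_apply_le (x - y) i

theorem convex_cube (d : ℕ) : Convex ℝ (cube d) := by
  intro x hx y hy a b ha hb hab i
  exact convex_Icc (0 : ℝ) 1 (hx i) (hy i) ha hb hab

theorem isClosed_cube (d : ℕ) : IsClosed (cube d) := by
  have : cube d = ⋂ i, {x : EuclideanSpace ℝ (Fin d) | x i ∈ Icc (0 : ℝ) 1} := by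
    ext x; simp [cube]
  rw [this]
  exact isClosed_iInter fun i => isClosed_Icc.preimage (by fun_prop)

theorem ball_diag_subset_cube {d : ℕ} {t s : ℝ} (h0 : s ≤ t) (h1 : t + s ≤ 1) :
    Metric.ball (diag d t) s ⊆ cube d := by
  intro x hx i
  have h := (abs_apply_sub_le x (diag d t) i).trans_lt hx
  rw [diag_apply, abs_lt] at h
  constructor <;> linarith [h.1, h.2]

theorem diag_mem_cube {d : ℕ} {t : ℝ} (h0 : 0 ≤ t) (h1 : t ≤ 1) : diag d t ∈ cube d :=
  fun _ => ⟨h0, h1⟩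

theorem exists_of_mem_frontier_cube {d : ℕ} {p : EuclideanSpace ℝ (Fin d)}
    (hp : p ∈ frontier (cube d)) : ∃ i, p i = 0 ∨ p i = 1 := by
  by_contra! h
  have hpc : p ∈ cube d := (isClosed_cube d).frontier_subset hp
  refine hp.2 (mem_interior.2 ⟨{x | ∀ i, x i ∈ Ioo (0 : ℝ) 1},
    fun x hx i => Ioo_subset_Icc_self (hx i), ?_, fun i => ?_⟩)
  · have : {x : EuclideanSpace ℝ (Fin d) | ∀ i, x i ∈ Ioo (0 : ℝ) 1} =
        ⋂ i, {x : EuclideanSpace ℝ (Fin d) | x i ∈ Ioo (0 : ℝ) 1} := by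
      ext x; simp
    rw [this]
    exact isOpen_iInter_of_finite fun i => isOpen_Ioo.preimage (by fun_prop)
  · exact ⟨(hpc i).1.lt_of_ne' (h i).1, (hpc i).2.lt_of_ne (h i).2⟩

theorem mem_frontier_cube {d : ℕ} {p : EuclideanSpace ℝ (Fin d)} (hp : p ∈ cube d) {i : Fin d}
    (hi : p i = 1) : p ∈ frontier (cube d) := by
  refine ⟨subset_closure hp, fun hint => ?_⟩
  obtain ⟨ε, hε, hb⟩ := Metric.mem_nhds_iff.1 (mem_interior_iff_mem_nhds.1 hint)
  have hmem : p + EuclideanSpace.single i (ε / 2) ∈ cube d := hb (by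
    rw [Metric.mem_ball, dist_eq_norm, add_sub_cancel_left, PiLp.norm_single,
      Real.norm_of_nonneg (by positivity)]
    linarith)
  have := (hmem i).2
  simp only [PiLp.add_apply, PiLp.single_apply, if_true, hi] at this
  linarith

/-! ### Shortest paths: existence, length and clearance -/

section ShortestPath

variable {d : ℕ} {ξ : ℝ}

theorem sqrt_mul_div_sqrt (hd : 0 < d) (x : ℝ) : √(d : ℝ) * (x / √(d : ℝ)) = x := by
  have : (0 : ℝ) < √(d : ℝ) := by positivity
  field_simp

theorem div_sqrt_lt_half (hd : 0 < d) (hξd : ξ < √(d : ℝ) / 2) : ξ / √(d : ℝ) < 1 / 2 := by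
  have : (0 : ℝ) < √(d : ℝ) := by positivity
  rw [div_lt_iff₀ this]; linarith

theorem closure_goal_subset :
    closure (cubeProblem d ξ).goal ⊆ Metric.closedBall (diag d 1) ξ :=
  closure_minimal (inter_subset_right.trans Metric.ball_subset_closedBall)
    Metric.isClosed_closedBall

/-- This point lies on the sphere, outside the open ball, but it is a limit of diagonal points
strictly between it and the corner, which belong to the goal. -/
theorem diag_mem_closure_goal (hd : 0 < d) (hξ : 0 < ξ) (hξd : ξ < √(d : ℝ) / 2) :
    diag d (1 - ξ / √(d : ℝ)) ∈ closure (cubeProblem d ξ).goal := by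
  have h1 := div_sqrt_lt_half hd hξd
  have h2 := sqrt_mul_div_sqrt hd ξ
  have hs : (0 : ℝ) < √(d : ℝ) := by positivity
  have hq : 0 < ξ / √(d : ℝ) := by positivity
  have hcont : Continuous (diag d) := by unfold diag; fun_prop
  have hmaps : MapsTo (diag d) (Ioo (1 - ξ / √(d : ℝ)) 1) (cubeProblem d ξ).goal := by
    intro t ht
    refine ⟨diag_mem_cube (by linarith [ht.1]) ht.2.le, ?_⟩
    change dist (diag d t) (diag d 1) < ξ
    rw [dist_diag, abs_of_neg (by linarith [ht.2])]
    have := ht.1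
    nlinarith
  refine map_mem_closure hcont ?_ hmaps
  rw [closure_Ioo (by linarith)]
  exact ⟨le_rfl, by linarith⟩

theorem dist_le_arcLength {E : Type*} [PseudoMetricSpace E] (σ : unitInterval → E) :
    ENNReal.ofReal (dist (σ 0) (σ 1)) ≤ arcLength σ := by
  rw [← edist_dist]
  exact eVariationOn.edist_le σ (mem_univ _) (mem_univ _)

theorem dist_add_dist_le_arcLength {E : Type*} [PseudoMetricSpace E] (σ : unitInterval → E)
    (τ : unitInterval) :
    ENNReal.ofReal (dist (σ 0) (σ τ) + dist (σ τ) (σ 1)) ≤ arcLength σ := by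
  rw [ENNReal.ofReal_add dist_nonneg dist_nonneg, ← edist_dist, ← edist_dist]
  have h0 : (0 : unitInterval) ≤ τ := τ.2.1
  have h1 : τ ≤ (1 : unitInterval) := τ.2.2
  have h := eVariationOn.Icc_add_Icc σ (s := univ) h0 h1 (mem_univ τ)
  calc edist (σ 0) (σ τ) + edist (σ τ) (σ 1)
      ≤ eVariationOn σ (univ ∩ Icc 0 τ) + eVariationOn σ (univ ∩ Icc τ 1) := by
        gcongr
        · exact eVariationOn.edist_le σ ⟨mem_univ _, le_rfl, h0⟩ ⟨mem_univ _, h0, le_rfl⟩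
        · exact eVariationOn.edist_le σ ⟨mem_univ _, le_rfl, h1⟩ ⟨mem_univ _, h1, le_rfl⟩
    _ = eVariationOn σ (univ ∩ Icc 0 1) := h
    _ ≤ arcLength σ := eVariationOn.mono σ (subset_univ _)

theorem sub_le_dist_of_feasible {σ : unitInterval → EuclideanSpace ℝ (Fin d)}
    (hσ : Feasible (cubeProblem d ξ) σ) : √(d : ℝ) / 2 - ξ ≤ dist (σ 0) (σ 1) := by
  have h0 : σ 0 = diag d (1 / 2) := hσ.2.2.1
  have h1 : dist (σ 1) (diag d 1) ≤ ξ := closure_goal_subset hσ.2.2.2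
  have h2 : dist (diag d (1 / 2)) (diag d 1) = √(d : ℝ) / 2 := by
    rw [dist_diag, abs_of_neg (by norm_num)]; ring
  have := dist_triangle (diag d (1 / 2)) (σ 1) (diag d 1)
  rw [h0]; linarith

/-- The straight path along the diagonal. -/
noncomputable def straightPath (d : ℕ) (ξ : ℝ) (τ : unitInterval) : EuclideanSpace ℝ (Fin d) :=
  diag d (1 / 2 + τ * (1 / 2 - ξ / √(d : ℝ)))

/-- The path is Lipschitz with the claimed length as constant, and the identity of the unit interval
has variation at most 1. -/
theorem arcLength_straightPath_le (hd : 0 < d) (hξd : ξ < √(d : ℝ) / 2) :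
    arcLength (straightPath d ξ) ≤ ENNReal.ofReal (√(d : ℝ) / 2 - ξ) := by
  have h1 := div_sqrt_lt_half hd hξd
  have h2 := sqrt_mul_div_sqrt hd ξ
  have hL : 0 ≤ √(d : ℝ) / 2 - ξ := by linarith
  set K : NNReal := (√(d : ℝ) / 2 - ξ).toNNReal with hK
  have hlip : LipschitzOnWith K
      (fun t : ℝ => diag d (1 / 2 + t * (1 / 2 - ξ / √(d : ℝ)))) univ := by
    refine LipschitzOnWith.of_dist_le_mul fun a _ b _ => ?_
    rw [dist_diag, hK, Real.coe_toNNReal _ hL, Real.dist_eq,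
      show 1 / 2 + a * (1 / 2 - ξ / √(d : ℝ)) - (1 / 2 + b * (1 / 2 - ξ / √(d : ℝ))) =
        (a - b) * (1 / 2 - ξ / √(d : ℝ)) by ring, abs_mul,
      abs_of_pos (show 0 < 1 / 2 - ξ / √(d : ℝ) by linarith)]
    apply le_of_eq
    linear_combination (- |a - b|) * h2
  have hvar : eVariationOn (fun τ : unitInterval => (τ : ℝ)) univ ≤ 1 := by
    have := MonotoneOn.eVariationOn_eq (f := fun τ : unitInterval => (τ : ℝ)) (s := univ)
      (a := 0) (b := 1) (fun a _ b _ hab => hab) (mem_univ _) (mem_univ _)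
    have huniv : (univ : Set unitInterval) ∩ Icc 0 1 = univ := by
      ext x; simpa using unitInterval.le_one' (t := x)
    rw [huniv] at this
    simpa using this.le
  calc arcLength (straightPath d ξ)
      ≤ K * eVariationOn (fun τ : unitInterval => (τ : ℝ)) univ :=
        hlip.comp_eVariationOn_le (mapsTo_univ _ _)
    _ ≤ K * 1 := by gcongr
    _ = _ := by rw [mul_one]; rfl

theorem feasible_straightPath (hd : 0 < d) (hξ : 0 < ξ) (hξd : ξ < √(d : ℝ) / 2) :
    Feasible (cubeProblem d ξ) (straightPath d ξ) := by
  have h1 := div_sqrt_lt_half hd hξd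
  have hq : 0 < ξ / √(d : ℝ) := by positivity
  refine ⟨⟨?_, ((arcLength_straightPath_le hd hξd).trans_lt ENNReal.ofReal_lt_top).ne⟩,
    fun τ => ?_, ?_, ?_⟩
  · unfold straightPath diag; fun_prop
  · have ht0 := τ.2.1
    have ht1 := τ.2.2
    exact diag_mem_cube (by nlinarith) (by nlinarith)
  · simp [straightPath, cubeProblem, diag]
  · have : straightPath d ξ 1 = diag d (1 - ξ / √(d : ℝ)) := by
      unfold straightPath; congr 1; simp; ring
    rw [this]
    exact diag_mem_closure_goal hd hξ hξd

theorem le_arcLength_of_feasible {σ : unitInterval → EuclideanSpace ℝ (Fin d)}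
    (hσ : Feasible (cubeProblem d ξ) σ) : ENNReal.ofReal (√(d : ℝ) / 2 - ξ) ≤ arcLength σ :=
  (ENNReal.ofReal_le_ofReal (sub_le_dist_of_feasible hσ)).trans (dist_le_arcLength σ)

theorem isShortest_straightPath (hd : 0 < d) (hξ : 0 < ξ) (hξd : ξ < √(d : ℝ) / 2) :
    IsShortest (cubeProblem d ξ) (straightPath d ξ) :=
  ⟨feasible_straightPath hd hξ hξd, fun _ hσ =>
    (arcLength_straightPath_le hd hξd).trans (le_arcLength_of_feasible hσ)⟩

theorem optCost_cubeProblem (hd : 0 < d) (hξ : 0 < ξ) (hξd : ξ < √(d : ℝ) / 2) :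
    optCost (cubeProblem d ξ) = ENNReal.ofReal (√(d : ℝ) / 2 - ξ) := by
  have h : arcLength (straightPath d ξ) ∈ arcLength '' {σ | Feasible (cubeProblem d ξ) σ} :=
    ⟨_, feasible_straightPath hd hξ hξd, rfl⟩
  refine le_antisymm ((sInf_le h).trans (arcLength_straightPath_le hd hξd)) (le_sInf ?_)
  rintro _ ⟨σ, hσ, rfl⟩
  exact le_arcLength_of_feasible hσ

/-- Minimal length forces equality in the triangle inequality for center, `σ τ` and corner. By
strict convexity of the Euclidean norm, `σ τ` then lies on the diagonal. -/
theorem IsShortest.exists_eq_diag (hd : 0 < d) (hξ : 0 < ξ) (hξd : ξ < √(d : ℝ) / 2)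
    {σ : unitInterval → EuclideanSpace ℝ (Fin d)} (hσ : IsShortest (cubeProblem d ξ) σ)
    (τ : unitInterval) : ∃ t, 1 / 2 ≤ t ∧ t ≤ 1 - ξ / √(d : ℝ) ∧ σ τ = diag d t := by
  have hs : (0 : ℝ) < √(d : ℝ) := by positivity
  have hlen : arcLength σ ≤ ENNReal.ofReal (√(d : ℝ) / 2 - ξ) :=
    (hσ.2 _ (feasible_straightPath hd hξ hξd)).trans (arcLength_straightPath_le hd hξd)
  have hsum := (ENNReal.ofReal_le_ofReal_iff (by linarith)).1
    ((dist_add_dist_le_arcLength σ τ).trans hlen)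
  have h0 : σ 0 = diag d (1 / 2) := hσ.1.2.2.1
  have h1 : dist (σ 1) (diag d 1) ≤ ξ := closure_goal_subset hσ.1.2.2.2
  have h2 : dist (diag d (1 / 2)) (diag d 1) = √(d : ℝ) / 2 := by
    rw [dist_diag, abs_of_neg (by norm_num)]; ring
  rw [h0] at hsum
  have h3 := dist_triangle (σ τ) (σ 1) (diag d 1)
  have h4 := dist_triangle (diag d (1 / 2)) (σ τ) (diag d 1)
  have hw : Wbtw ℝ (diag d (1 / 2)) (σ τ) (diag d 1) := dist_add_dist_eq_iff.1 (by linarith)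
  obtain ⟨u, hu, huσ⟩ := hw
  have heq : σ τ = diag d (1 / 2 + u / 2) := by
    rw [← huσ]
    ext i
    simp [AffineMap.lineMap_apply]
    ring
  refine ⟨_, by linarith [hu.1], ?_, heq⟩
  have h5 : dist (diag d (1 / 2)) (σ τ) ≤ √(d : ℝ) / 2 - ξ := by
    linarith [dist_nonneg (x := σ τ) (y := σ 1)]
  rw [heq, dist_diag, abs_of_nonpos (by linarith [hu.1])] at h5
  have h6 : ξ / √(d : ℝ) ≤ 1 / 2 - u / 2 := by
    rw [div_le_iff₀ hs]; linarith
  linarith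

/-- For `t ≥ 1 / 2` the nearest faces to `diag d t` are those through the corner, at distance `1 -
t`; this is smallest at the end of the path. -/
theorem isGreatest_clearance (hd : 0 < d) (hξ : 0 < ξ) (hξd : ξ < √(d : ℝ) / 2)
    {σ : unitInterval → EuclideanSpace ℝ (Fin d)} (hσ : IsShortest (cubeProblem d ξ) σ) :
    IsGreatest {δ | StrongClearance (frontier (cube d)) δ σ} (ξ / √(d : ℝ)) := by
  have hs : (0 : ℝ) < √(d : ℝ) := by positivity
  have hq : 0 < ξ / √(d : ℝ) := by positivity
  have hlt := div_sqrt_lt_half hd hξd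
  refine ⟨⟨hq, fun τ p hp => ?_⟩, fun δ hδ => ?_⟩
  · obtain ⟨t, ht0, ht1, hτ⟩ := hσ.exists_eq_diag hd hξ hξd τ
    obtain ⟨i, hi⟩ := exists_of_mem_frontier_cube hp
    refine le_trans ?_ (abs_apply_sub_le (σ τ) p i)
    rw [hτ, diag_apply]
    rcases hi with hi | hi <;> rw [hi]
    · rw [sub_zero]; exact le_trans (by linarith) (le_abs_self t)
    · rw [abs_sub_comm]; exact le_trans (by linarith) (le_abs_self _)
  · obtain ⟨t, ht0, ht1, hτ⟩ := hσ.exists_eq_diag hd hξ hξd 1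
    have h1 : dist (σ 1) (diag d 1) ≤ ξ := closure_goal_subset hσ.1.2.2.2
    rw [hτ, dist_diag, abs_of_nonpos (by linarith)] at h1
    have h2 : 1 - t ≤ ξ / √(d : ℝ) := by rw [le_div_iff₀ hs]; linarith
    let i : Fin d := ⟨0, hd⟩
    -- The orthogonal projection of the endpoint onto a face realizes the distance.
    have hp : diag d t + EuclideanSpace.single i (1 - t) ∈ frontier (cube d) := by
      refine mem_frontier_cube (i := i) (fun j => ?_) (by simp)
      by_cases hj : j = i
      · subst hj; simp
      · simp only [PiLp.add_apply, diag_apply, PiLp.single_apply, hj, if_false,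
          add_zero]
        exact ⟨by linarith, by linarith⟩
    have := hδ.2 1 _ hp
    rw [hτ, dist_self_add_right, PiLp.norm_single,
      Real.norm_of_nonneg (by linarith)] at this
    exact this.trans h2

end ShortestPath

/-! ### Probability estimates: Markov's inequality for subsets, and samples missing a set -/

section Probability

variable {Ω E : Type*} [MeasurableSpace Ω] {Pr : Measure Ω}

theorem ae_mem_of_isUniform [MeasureSpace E] {S : Set E} (hSm : MeasurableSet S)
    {X : Ω → E} (hX : Measurable X) (hXu : pdf.IsUniform X S Pr volume) : ∀ᵐ ω ∂Pr, X ω ∈ S := by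
  have h : ∀ᵐ x ∂(Measure.map X Pr), x ∈ S := by
    rw [hXu]; exact ProbabilityTheory.ae_cond_mem hSm
  exact ae_of_ae_map hX.aemeasurable h

/-- Compare `M ^ k / k!` from above with `(m + 1 - k) ^ k / k!` from below, where `m + 1 - k ≥ m /
2`. The factor does not depend on `M`, so for fixed `k` the binomial coefficients in Markov's
inequality cost only a constant. -/
theorem choose_le_pow_mul_choose {M m k : ℕ} {C : ℝ} (hm : 2 * k ≤ m) (hC : (M : ℝ) ≤ C * m) :
    (M.choose k : ℝ) ≤ (2 * C) ^ k * m.choose k := by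
  have h1 : (M.choose k : ℝ) ≤ (M : ℝ) ^ k / (k.factorial : ℝ) := Nat.choose_le_pow_div k M
  have h2 := Nat.pow_le_choose (α := ℝ) k m
  rcases Nat.eq_zero_or_pos k with rfl | hk
  · simp
  have hmpos : (0 : ℝ) < m := by exact_mod_cast (show 0 < m by omega)
  have hC0 : 0 ≤ C := by
    by_contra h
    have := mul_neg_of_neg_of_pos (not_le.1 h) hmpos
    linarith [Nat.cast_nonneg (α := ℝ) M]
  have h3 : (m : ℝ) / 2 ≤ ((m + 1 - k : ℕ) : ℝ) := by
    rw [div_le_iff₀ (by norm_num)]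
    exact_mod_cast (show m ≤ (m + 1 - k) * 2 by omega)
  calc (M.choose k : ℝ) ≤ (M : ℝ) ^ k / (k.factorial : ℝ) := h1
    _ ≤ (C * m) ^ k / (k.factorial : ℝ) := by gcongr
    _ = (2 * C) ^ k * ((m / 2 : ℝ) ^ k / (k.factorial : ℝ)) := by
        rw [← mul_div_assoc, ← mul_pow]; congr 2; ring
    _ ≤ (2 * C) ^ k * (((m + 1 - k : ℕ) : ℝ) ^ k / (k.factorial : ℝ)) := by gcongr
    _ ≤ _ := by gcongr

variable [IsProbabilityMeasure Pr]

/-- Markov's inequality for the number of `k`-subsets of the set of events that occur. -/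
theorem measureReal_le_card_mul_choose_le {ι : Type*} (I : Finset ι) {A : ι → Set Ω}
    (hA : ∀ i, MeasurableSet (A i)) (k m : ℕ) {p : ℝ}
    (hp : ∀ T ⊆ I, T.card = k → Pr.real (⋂ i ∈ T, A i) ≤ p) {B : Set Ω}
    (hB : ∀ ω ∈ B, ∃ T ⊆ I, m ≤ T.card ∧ ∀ i ∈ T, ω ∈ A i) :
    Pr.real B * (m.choose k : ℝ) ≤ (I.card.choose k : ℝ) * p := by
  classical
  -- `f` counts the `k`-subsets of `I` all of whose events occur; on `B` there are at least
  -- `m.choose k` of them.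
  set f : Ω → ℝ≥0∞ := fun ω => ∑ T ∈ I.powersetCard k, (⋂ i ∈ T, A i).indicator 1 ω with hf
  have hTm : ∀ T : Finset ι, MeasurableSet (⋂ i ∈ T, A i) := fun T =>
    T.measurableSet_biInter fun i _ => hA i
  have hfm : Measurable f := Finset.measurable_fun_sum _ fun T _ =>
    measurable_one.indicator (hTm T)
  have hint : ∫⁻ ω, f ω ∂Pr ≤ ENNReal.ofReal ((I.card.choose k : ℝ) * p) := by
    rw [hf, lintegral_finsetSum _ fun T _ => measurable_one.indicator (hTm T)]
    calc ∑ T ∈ I.powersetCard k, ∫⁻ ω, (⋂ i ∈ T, A i).indicator 1 ω ∂Pr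
        ≤ ∑ T ∈ I.powersetCard k, ENNReal.ofReal p := by
          refine Finset.sum_le_sum fun T hT => ?_
          rw [lintegral_indicator_one (hTm T), ← ofReal_measureReal]
          exact ENNReal.ofReal_le_ofReal
            (hp T (Finset.mem_powersetCard.1 hT).1 (Finset.mem_powersetCard.1 hT).2)
      _ = _ := by
          rw [Finset.sum_const, Finset.card_powersetCard, nsmul_eq_mul,
            ENNReal.ofReal_mul (by positivity), ENNReal.ofReal_natCast]
  have hsub : B ⊆ {ω | (m.choose k : ℝ≥0∞) ≤ f ω} := by
    intro ω hω
    obtain ⟨T, hTI, hTm, hT⟩ := hB ω hω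
    have h1 : ∑ S ∈ T.powersetCard k, (⋂ i ∈ S, A i).indicator (1 : Ω → ℝ≥0∞) ω =
        (T.card.choose k : ℝ≥0∞) := by
      rw [← Finset.card_powersetCard, Finset.card_eq_sum_ones, Nat.cast_sum]
      refine Finset.sum_congr rfl fun S hS => ?_
      rw [indicator_of_mem]
      · simp
      · exact mem_iInter₂.2 fun i hi => hT i ((Finset.mem_powersetCard.1 hS).1 hi)
    calc (m.choose k : ℝ≥0∞) ≤ (T.card.choose k : ℝ≥0∞) := by
          exact_mod_cast Nat.choose_le_choose k hTm
      _ = _ := h1.symm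
      _ ≤ f ω := Finset.sum_le_sum_of_subset (Finset.powersetCard_mono hTI)
  -- The sign of `p` is not assumed: either there is no `k`-subset, or `p` bounds a probability.
  have hrhs : 0 ≤ (I.card.choose k : ℝ) * p := by
    rcases Nat.eq_zero_or_pos (I.card.choose k) with h1 | h1
    · simp [h1]
    · obtain ⟨T, hT⟩ : (I.powersetCard k).Nonempty := by
        rw [← Finset.card_pos, Finset.card_powersetCard]; exact h1
      obtain ⟨hT1, hT2⟩ := Finset.mem_powersetCard.1 hT
      exact mul_nonneg (by positivity) (measureReal_nonneg.trans (hp T hT1 hT2))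
  have hmarkov := (mul_meas_ge_le_lintegral (μ := Pr) hfm (m.choose k : ℝ≥0∞)).trans hint
  have h2 : ENNReal.ofReal (Pr.real B * (m.choose k : ℝ)) ≤
      ENNReal.ofReal ((I.card.choose k : ℝ) * p) := by
    refine le_trans ?_ hmarkov
    rw [ENNReal.ofReal_mul measureReal_nonneg, ofReal_measureReal, ENNReal.ofReal_natCast,
      mul_comm]
    gcongr
  exact (ENNReal.ofReal_le_ofReal_iff hrhs).1 h2

/-- The probability that `n` independent uniform samples in `S` avoid a subset of `S`. -/
theorem measureReal_forall_notMem_le [MeasureSpace E] {S : Set E}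
    (hS0 : volume S ≠ 0) (hSt : volume S ≠ ∞) {n : ℕ} {X : Fin n → Ω → E}
    (hXm : ∀ i, Measurable (X i)) (hXi : iIndepFun X Pr)
    (hXu : ∀ i, pdf.IsUniform (X i) S Pr volume) {B : Set E} (hB : MeasurableSet B)
    (hBS : B ⊆ S) :
    Pr.real {ω | ∀ i, X i ω ∉ B} ≤ Real.exp (-(n * (volume.real B / volume.real S))) := by
  have hset : {ω | ∀ i, X i ω ∉ B} = ⋂ i ∈ (Finset.univ : Finset (Fin n)), X i ⁻¹' Bᶜ := by
    ext ω; simp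
  have hone : ∀ i, Pr.real (X i ⁻¹' Bᶜ) = 1 - volume.real B / volume.real S := by
    intro i
    rw [preimage_compl, probReal_compl_eq_one_sub ((hXm i) hB), measureReal_def,
      (hXu i).measure_preimage hS0 hSt hB, inter_eq_self_of_subset_right hBS, ENNReal.toReal_div,
      measureReal_def, measureReal_def]
  have hprod : Pr.real {ω | ∀ i, X i ω ∉ B} = (1 - volume.real B / volume.real S) ^ n := by
    rw [hset, measureReal_def, hXi.measure_inter_preimage_eq_mul Finset.univ
      (sets := fun _ => Bᶜ) fun i _ => hB.compl, ENNReal.toReal_prod]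
    simp only [← measureReal_def, hone, Finset.prod_const, Finset.card_univ, Fintype.card_fin]
  rw [hprod]
  have hle : volume.real B / volume.real S ≤ 1 :=
    div_le_one_of_le₀ (measureReal_mono hBS hSt) measureReal_nonneg
  calc (1 - volume.real B / volume.real S) ^ n
      ≤ Real.exp (-(volume.real B / volume.real S)) ^ n := by
        refine pow_le_pow_left₀ (by linarith) (Real.one_sub_le_exp_neg _) n
    _ = _ := by rw [← Real.exp_nat_mul]; ring_nf

end Probability

/-! ### Short walks from samples in balls -/

/-- A hop costs at most `g` plus the deviations at its two ends, so every deviation is paid twice,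
except the last one, paid once so far. The extra distance on the left accounts for the second
payment and makes the induction close. -/
theorem exists_reach_of_dist_lt {E : Type*} [NormedAddCommGroup E] {V : Finset E}
    {x y : ℕ → E} {g s r : ℝ} (h0 : y 0 = x 0) (hr : 2 * s + g ≤ r)
    (hstep : ∀ m, dist (x (m + 1)) (x m) ≤ g) (M : ℕ) (hy : ∀ m ≤ M, dist (y m) (x m) < s)
    (hV : ∀ m < M, y (m + 1) ∈ V) :
    ∃ L, Reach (x 0) V r (y M) L ∧
      L + dist (y M) (x M) ≤ M * g + 2 * ∑ m ∈ Finset.range M, dist (y (m + 1)) (x (m + 1)) := by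
  induction M with
  | zero => exact ⟨0, h0 ▸ .root, by simp [h0]⟩
  | succ M ih =>
    obtain ⟨L, hL, hle⟩ := ih (fun m hm => hy m (by omega)) (fun m hm => hV m (by omega))
    have h1 : ‖y (M + 1) - y M‖ ≤ dist (y (M + 1)) (x (M + 1)) + g + dist (y M) (x M) := by
      rw [← dist_eq_norm]
      have h2 := dist_triangle4 (y (M + 1)) (x (M + 1)) (x M) (y M)
      have h3 := hstep M
      rw [dist_comm (x M) (y M)] at h2
      linarith
    refine ⟨_, hL.step (hV M (by omega)) ?_, ?_⟩
    · have h2 := hy M (by omega)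
      have h3 := hy (M + 1) le_rfl
      linarith
    · rw [Finset.sum_range_succ]
      push_cast
      linarith

/-- If every large ball along `x 0, …, x M` contains a sample and the small balls without a sample
are few, then the disk graph has a short walk from `x 0` to the last large ball. -/
theorem exists_reach_of_balls {E : Type*} [NormedAddCommGroup E] {V : Finset E}
    {x : ℕ → E} {g s β r : ℝ} (hs : 0 < s) (hβ : 0 ≤ β) (hr : 2 * s + g ≤ r)
    (hstep : ∀ m, dist (x (m + 1)) (x m) ≤ g) {M : ℕ} (hM : M ≠ 0) {n : ℕ} {p : Fin n → E}
    (hp : ∀ i, p i ∈ V) (hbig : ∀ m < M, ∃ i, p i ∈ Metric.ball (x (m + 1)) s)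
    {T : Finset ℕ} (hT : ∀ m < M, m ∉ T → ∃ i, p i ∈ Metric.ball (x (m + 1)) (β * s))
    (hTc : (T.card : ℝ) ≤ β * M) :
    ∃ v ∈ Metric.ball (x M) s, ∃ L ≤ M * (g + 4 * β * s), Reach (x 0) V r v L := by
  have hex : ∀ m, ∃ y, (m < M → y ∈ V ∧ dist y (x (m + 1)) < s ∧
      dist y (x (m + 1)) ≤ β * s + if m ∈ T then s else 0) := by
    intro m
    by_cases hm : m < M
    · by_cases hmT : m ∈ T
      · obtain ⟨i, hi⟩ := hbig m hm
        refine ⟨p i, fun _ => ⟨hp i, hi, ?_⟩⟩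
        rw [if_pos hmT]
        have : 0 ≤ β * s := by positivity
        linarith [Metric.mem_ball.1 hi]
      · obtain ⟨i, hi⟩ := hT m hm hmT
        obtain ⟨j, hj⟩ := hbig m hm
        by_cases hβs : β * s ≤ s
        · exact ⟨p i, fun _ => ⟨hp i, (Metric.mem_ball.1 hi).trans_le hβs, by
            rw [if_neg hmT, add_zero]; exact (Metric.mem_ball.1 hi).le⟩⟩
        · exact ⟨p j, fun _ => ⟨hp j, hj, by
            rw [if_neg hmT, add_zero]; linarith [Metric.mem_ball.1 hj]⟩⟩
    · exact ⟨0, fun h => absurd h hm⟩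
  choose z hz using hex
  -- The walk starts at `x 0` itself; samples are needed only from index 1 on.
  let y : ℕ → E := fun m => Nat.casesOn m (x 0) z
  obtain ⟨L, hL, hle⟩ := exists_reach_of_dist_lt (V := V) (x := x) (y := y) (g := g) (s := s)
    (r := r) rfl hr hstep M (fun m hm => by
      cases m with
      | zero => simpa [y] using hs
      | succ m => exact (hz m (by omega)).2.1) (fun m hm => (hz m hm).1)
  obtain ⟨N, rfl⟩ := Nat.exists_eq_succ_of_ne_zero hM
  refine ⟨y (N + 1), (hz N (by omega)).2.1, L, ?_, hL⟩
  have hsum : ∑ m ∈ Finset.range (N + 1), dist (y (m + 1)) (x (m + 1)) ≤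
      (N + 1 : ℕ) * (β * s) + T.card * s := by
    calc ∑ m ∈ Finset.range (N + 1), dist (y (m + 1)) (x (m + 1))
        ≤ ∑ m ∈ Finset.range (N + 1), (β * s + if m ∈ T then s else 0) :=
          Finset.sum_le_sum fun m hm => (hz m (Finset.mem_range.1 hm)).2.2
      _ = (N + 1 : ℕ) * (β * s) + ((Finset.range (N + 1)).filter (· ∈ T)).card * s := by
          rw [Finset.sum_add_distrib, ← Finset.sum_filter]
          simp
      _ ≤ _ := by
          gcongr
          intro m hm
          exact (Finset.mem_filter.1 hm).2
  -- The exceptional indices deviate by up to `s` more but are few, so they add no more than the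
  -- basic deviation `β * s` summed over all indices. Counted twice, the two parts give the `4 * β *
  -- s` per step.
  have h1 : (T.card : ℝ) * s ≤ β * (N + 1 : ℕ) * s := by gcongr
  have h2 : 0 ≤ dist (y (N + 1)) (x (N + 1)) := dist_nonneg
  linarith

/-! ### Balls along the diagonal of the cube -/

section Cube

variable {d : ℕ} {ξ : ℝ}

/-- Equally spaced points on the diagonal, starting at the center of the cube. -/
noncomputable def center (d : ℕ) (g : ℝ) (m : ℕ) : EuclideanSpace ℝ (Fin d) :=
  diag d (1 / 2 + m * (g / √(d : ℝ)))

theorem dist_center (hd : 0 < d) {g : ℝ} (hg : 0 ≤ g) (m l : ℕ) :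
    dist (center d g m) (center d g l) = g * |(m : ℝ) - l| := by
  rw [center, center, dist_diag]
  rw [show 1 / 2 + m * (g / √(d : ℝ)) - (1 / 2 + l * (g / √(d : ℝ))) =
    (g / √(d : ℝ)) * ((m : ℝ) - l) by ring, abs_mul, ← mul_assoc, abs_of_nonneg (by positivity),
    sqrt_mul_div_sqrt hd]

/-- The number of steps of length `g` that lead from the center of the cube to depth at least `s`
in the goal region. -/
noncomputable def numSteps (d : ℕ) (ξ g s : ℝ) : ℕ := ⌈(√(d : ℝ) / 2 - ξ + s) / g⌉₊

theorem le_numSteps_mul {g s : ℝ} (hg : 0 < g) :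
    √(d : ℝ) / 2 - ξ + s ≤ numSteps d ξ g s * g := by
  rw [← div_le_iff₀ hg]
  exact Nat.le_ceil _

theorem numSteps_mul_lt {g s : ℝ} (hg : 0 < g) (hs : 0 ≤ √(d : ℝ) / 2 - ξ + s) :
    numSteps d ξ g s * g < √(d : ℝ) / 2 - ξ + s + g := by
  have h : (numSteps d ξ g s : ℝ) < (√(d : ℝ) / 2 - ξ + s) / g + 1 :=
    Nat.ceil_lt_add_one (by positivity)
  calc numSteps d ξ g s * g < ((√(d : ℝ) / 2 - ξ + s) / g + 1) * g := by gcongr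
    _ = _ := by field_simp

theorem ball_center_subset_cube (hd : 0 < d) (hξd : ξ < √(d : ℝ) / 2) {g s : ℝ}
    (hg : 0 < g) (hs : 0 < s) (hsmall : s * (√(d : ℝ) + 1) + g ≤ ξ) {m : ℕ}
    (hm : m ≤ numSteps d ξ g s) : Metric.ball (center d g m) s ⊆ cube d := by
  have hq : (0 : ℝ) < √(d : ℝ) := by positivity
  have h1 : (m : ℝ) * g ≤ √(d : ℝ) / 2 - ξ + s + g :=
    le_trans (by gcongr) (numSteps_mul_lt (ξ := ξ) hg (by linarith)).le
  have h2 : (m : ℝ) * (g / √(d : ℝ)) ≤ 1 / 2 - s := by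
    rw [← mul_div_assoc, div_le_iff₀ hq]
    nlinarith
  refine ball_diag_subset_cube ?_ (by linarith)
  have h3 : (0 : ℝ) ≤ m * (g / √(d : ℝ)) := by positivity
  have h4 : s * √(d : ℝ) < √(d : ℝ) / 2 := by nlinarith
  nlinarith

/-- The last center is at depth at least `s` inside the goal ball, and rounding up the number of
steps does not carry it past the corner. -/
theorem ball_center_subset_goal (hd : 0 < d) (hξd : ξ < √(d : ℝ) / 2) {g s : ℝ}
    (hg : 0 < g) (hs : 0 < s) (hsmall : s * (√(d : ℝ) + 1) + g ≤ ξ) :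
    Metric.ball (center d g (numSteps d ξ g s)) s ⊆ (cubeProblem d ξ).goal := by
  refine subset_inter (ball_center_subset_cube hd hξd hg hs hsmall le_rfl) ?_
  refine Metric.ball_subset_ball' ?_
  change s + dist _ (diag d 1) ≤ ξ
  have hq : (0 : ℝ) < √(d : ℝ) := by positivity
  have h1 := numSteps_mul_lt (d := d) (ξ := ξ) (s := s) hg (by linarith)
  have h2 := le_numSteps_mul (d := d) (ξ := ξ) (s := s) hg
  have h3 : √(d : ℝ) * (numSteps d ξ g s * (g / √(d : ℝ))) = numSteps d ξ g s * g := by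
    rw [← mul_div_assoc, sqrt_mul_div_sqrt hd]
  have h4 : 0 < s * √(d : ℝ) := by positivity
  have h5 : 1 / 2 + numSteps d ξ g s * (g / √(d : ℝ)) - 1 ≤ 0 := by
    by_contra! h
    have := mul_pos hq h
    linarith
  rw [center, dist_diag, abs_of_nonpos h5]
  linarith

/-- The deterministic core. With spacing `θ * s` and small radius `θ * γ * s`, the walk costs `θ * s
* (1 + 4 * γ)` per step, hence a relative excess governed by `γ` alone, whatever `θ` is. -/
theorem cost_le_of_balls (hd : 0 < d) (hξd : ξ < √(d : ℝ) / 2) {θ γ s ε : ℝ}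
    (hθ : 0 < θ) (hγ : 0 < γ) (hs : 0 < s) (hsmall : s * (√(d : ℝ) + 1 + θ) ≤ ξ)
    (hlen : (√(d : ℝ) / 2 - ξ + (1 + θ) * s) * (1 + 4 * γ) ≤ (1 + ε) * (√(d : ℝ) / 2 - ξ))
    {n : ℕ} {p : Fin n → EuclideanSpace ℝ (Fin d)} (hp : ∀ i, p i ∈ cube d)
    (hbig : ∀ m < numSteps d ξ (θ * s) s, ∃ i, p i ∈ Metric.ball (center d (θ * s) (m + 1)) s)
    {T : Finset ℕ} (hT : ∀ m < numSteps d ξ (θ * s) s, m ∉ T →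
      ∃ i, p i ∈ Metric.ball (center d (θ * s) (m + 1)) (θ * γ * s))
    (hTc : (T.card : ℝ) ≤ θ * γ * numSteps d ξ (θ * s) s) {c : ℝ≥0∞}
    (hc : IsCost (cubeProblem d ξ) p ((2 + θ) * s) c) :
    c ≤ ENNReal.ofReal ((1 + ε) * (√(d : ℝ) / 2 - ξ)) := by
  classical
  have hg : 0 < θ * s := by positivity
  have hsmall' : s * (√(d : ℝ) + 1) + θ * s ≤ ξ := by linarith
  have hM : numSteps d ξ (θ * s) s ≠ 0 := by
    have h := le_numSteps_mul (d := d) (ξ := ξ) (s := s) hg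
    intro h0
    rw [h0, Nat.cast_zero, zero_mul] at h
    linarith
  obtain ⟨v, hv, L, hLle, hL⟩ := exists_reach_of_balls (V := nodes (cubeProblem d ξ) p)
    (x := center d (θ * s)) (g := θ * s) (s := s) (β := θ * γ) (r := (2 + θ) * s) hs
    (by positivity) (by linarith) (fun m => by rw [dist_center hd hg.le]; simp) hM (p := p)
    (mem_nodes _ p)
    hbig hT hTc
  have hinit : center d (θ * s) 0 = (cubeProblem d ξ).init := by
    simp [center, diag, cubeProblem]
  rw [hinit] at hL
  refine (hc.le_of_reach (convex_cube d) ?_ hp hL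
    (ball_center_subset_goal hd hξd hg hs hsmall' hv)).trans (ENNReal.ofReal_le_ofReal ?_)
  · exact diag_mem_cube (by norm_num) (by norm_num)
  · have h1 := (numSteps_mul_lt (d := d) (ξ := ξ) (s := s) hg (by linarith)).le
    calc L ≤ numSteps d ξ (θ * s) s * (θ * s + 4 * (θ * γ) * s) := hLle
      _ = numSteps d ξ (θ * s) s * (θ * s) * (1 + 4 * γ) := by ring
      _ ≤ (√(d : ℝ) / 2 - ξ + s + θ * s) * (1 + 4 * γ) := by gcongr
      _ ≤ _ := by linarith

end Cube

/-! ### A bound on the failure probability for fixed parameters -/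

section Bound

variable {d : ℕ} {ξ : ℝ}

theorem volume_cube_ne_zero (d : ℕ) : volume (cube d) ≠ 0 := by
  refine ((Metric.measure_ball_pos volume (diag d (1 / 2)) one_half_pos).trans_le
    (measure_mono (ball_diag_subset_cube le_rfl (by norm_num)))).ne'

theorem volume_cube_ne_top (d : ℕ) : volume (cube d) ≠ ∞ := by
  have h : cube d ⊆ Metric.closedBall (diag d 0) (√(d : ℝ)) := by
    intro x hx
    rw [Metric.mem_closedBall, EuclideanSpace.dist_eq]
    refine Real.sqrt_le_sqrt ?_
    calc ∑ i, dist (x i) (diag d 0 i) ^ 2 ≤ ∑ _i : Fin d, (1 : ℝ) := by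
          refine Finset.sum_le_sum fun i _ => ?_
          rw [diag_apply, Real.dist_eq, sub_zero, sq_abs]
          have := hx i
          nlinarith [this.1, this.2]
      _ = d := by simp
  exact ((measure_mono h).trans_lt Metric.isBounded_closedBall.measure_lt_top).ne

/-- The ratio of the volumes of the unit ball and the cube. -/
noncomputable def ballRatio (d : ℕ) : ℝ :=
  volume.real (Metric.ball (0 : EuclideanSpace ℝ (Fin d)) 1) / volume.real (cube d)

theorem volume_real_ball_div (x : EuclideanSpace ℝ (Fin d)) {s : ℝ} (hs : 0 < s) :
    volume.real (Metric.ball x s) / volume.real (cube d) = s ^ d * ballRatio d := by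
  rw [measureReal_def, Measure.addHaar_ball_of_pos volume x hs, finrank_euclideanSpace_fin,
    ENNReal.toReal_mul, ENNReal.toReal_ofReal (by positivity), ← measureReal_def, mul_div_assoc,
    ballRatio]

theorem disjoint_ball_center (hd : 0 < d) {g s : ℝ} (hg : 0 ≤ g) (h : 2 * s ≤ g) {m l : ℕ}
    (hml : m ≠ l) : Disjoint (Metric.ball (center d g m) s) (Metric.ball (center d g l) s) := by
  refine Metric.ball_disjoint_ball ?_
  rw [dist_center hd hg]
  have h1 : (1 : ℝ) ≤ |(m : ℝ) - l| := by
    have : (1 : ℤ) ≤ |(m : ℤ) - l| := Int.one_le_abs (sub_ne_zero.2 (by exact_mod_cast hml))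
    exact_mod_cast this
  nlinarith

variable {Ω : Type*} [MeasurableSpace Ω] {Pr : Measure Ω} [IsProbabilityMeasure Pr]

/-- A costly output requires a sample outside the cube (a null event), an empty big ball (union
bound), or at least `θ * γ * M` empty small balls (Markov for `k`-subsets). -/
theorem measureReal_cost_gt_le (hd : 0 < d) (hξ : 0 < ξ) (hξd : ξ < √(d : ℝ) / 2)
    {θ γ s ε : ℝ} (hθ : 0 < θ) (hγ : 0 < γ) (hγ' : γ ≤ 1 / 2) (hθγ : θ * γ ≤ 1) (hs : 0 < s)
    (hε : 0 < ε) (hsmall : s * (√(d : ℝ) + 1 + θ) ≤ ξ)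
    (hlen : (√(d : ℝ) / 2 - ξ + (1 + θ) * s) * (1 + 4 * γ) ≤ (1 + ε) * (√(d : ℝ) / 2 - ξ))
    {k : ℕ} (hk : 2 * (k : ℝ) ≤ θ * γ * numSteps d ξ (θ * s) s) {n : ℕ}
    {X : Fin n → Ω → EuclideanSpace ℝ (Fin d)} (hXm : ∀ i, Measurable (X i))
    (hXi : iIndepFun X Pr) (hXu : ∀ i, pdf.IsUniform (X i) (cube d) Pr volume) {c : Ω → ℝ≥0∞}
    (hc : ∀ ω, IsCost (cubeProblem d ξ) (fun i => X i ω) ((2 + θ) * s) (c ω)) :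
    Pr.real {ω | ENNReal.ofReal (1 + ε) * optCost (cubeProblem d ξ) < c ω} ≤
      numSteps d ξ (θ * s) s * Real.exp (-(n * (s ^ d * ballRatio d))) +
      (2 * (1 / (θ * γ))) ^ k * Real.exp (-(n * (k * ((θ * γ * s) ^ d * ballRatio d)))) := by
  classical
  set M := numSteps d ξ (θ * s) s with hM
  have hg : 0 < θ * s := by positivity
  have hsmall' : s * (√(d : ℝ) + 1) + θ * s ≤ ξ := by linarith
  have hβs : 0 < θ * γ * s := by positivity
  let big : ℕ → Set (EuclideanSpace ℝ (Fin d)) := fun m => Metric.ball (center d (θ * s) (m + 1)) s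
  let small : ℕ → Set (EuclideanSpace ℝ (Fin d)) := fun m =>
    Metric.ball (center d (θ * s) (m + 1)) (θ * γ * s)
  have hbig : ∀ m < M, big m ⊆ cube d := fun m hm =>
    ball_center_subset_cube hd hξd hg hs hsmall' (Nat.succ_le_of_lt hm)
  have hsmb : ∀ m, small m ⊆ big m := fun m => Metric.ball_subset_ball (by nlinarith)
  let N : Set Ω := {ω | ¬ ∀ i, X i ω ∈ cube d}
  let A : ℕ → Set Ω := fun m => {ω | ∀ i, X i ω ∉ big m}
  let D : ℕ → Set Ω := fun m => {ω | ∀ i, X i ω ∉ small m}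
  let B : Set Ω := {ω | ∃ T ⊆ Finset.range M, ⌈θ * γ * M⌉₊ ≤ T.card ∧ ∀ m ∈ T, ω ∈ D m}
  have hsub : {ω | ENNReal.ofReal (1 + ε) * optCost (cubeProblem d ξ) < c ω} ⊆
      N ∪ ((⋃ m ∈ Finset.range M, A m) ∪ B) := by
    intro ω hω
    by_contra hnot
    simp only [mem_union, not_or] at hnot
    obtain ⟨h1, h2, h3⟩ := hnot
    refine absurd (show _ < c ω from hω) (not_lt.2 ?_)
    rw [optCost_cubeProblem hd hξ hξd, ← ENNReal.ofReal_mul (by positivity)]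
    refine cost_le_of_balls hd hξd hθ hγ hs hsmall hlen (p := fun i => X i ω)
      (not_not.1 h1) (fun m hm => ?_) (T := (Finset.range M).filter fun m => ω ∈ D m)
      (fun m hm hmT => ?_) ?_ (hc ω)
    · by_contra! h
      exact h2 (mem_iUnion₂.2 ⟨m, Finset.mem_range.2 hm, h⟩)
    · by_contra! h
      exact hmT (Finset.mem_filter.2 ⟨Finset.mem_range.2 hm, h⟩)
    · by_contra! h
      exact h3 ⟨_, Finset.filter_subset _ _, Nat.ceil_le.2 h.le,
        fun m hm => (Finset.mem_filter.1 hm).2⟩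
  have hN : Pr.real N = 0 := by
    have : ∀ᵐ ω ∂Pr, ∀ i, X i ω ∈ cube d := ae_all_iff.2 fun i =>
      ae_mem_of_isUniform (isClosed_cube d).measurableSet (hXm i) (hXu i)
    rw [measureReal_def, show Pr N = 0 from this, ENNReal.toReal_zero]
  have hA : Pr.real (⋃ m ∈ Finset.range M, A m) ≤
      M * Real.exp (-(n * (s ^ d * ballRatio d))) := by
    refine (measureReal_biUnion_finset_le _ _).trans ?_
    calc ∑ m ∈ Finset.range M, Pr.real (A m)
        ≤ ∑ m ∈ Finset.range M, Real.exp (-(n * (s ^ d * ballRatio d))) := by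
          refine Finset.sum_le_sum fun m hm => ?_
          have := measureReal_forall_notMem_le (volume_cube_ne_zero d) (volume_cube_ne_top d)
            hXm hXi hXu (B := big m) Metric.isOpen_ball.measurableSet
            (hbig m (Finset.mem_range.1 hm))
          rwa [volume_real_ball_div _ hs] at this
      _ = _ := by rw [Finset.sum_const, Finset.card_range, nsmul_eq_mul]
  -- The small balls are disjoint because `γ ≤ 1 / 2`. That `k` of them are empty means that all
  -- samples avoid their union, whose volume is `k` times that of one ball.
  have hD : ∀ T ⊆ Finset.range M, T.card = k → Pr.real (⋂ m ∈ T, D m) ≤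
      Real.exp (-(n * (k * ((θ * γ * s) ^ d * ballRatio d)))) := by
    intro T hT hTk
    have hset : (⋂ m ∈ T, D m) = {ω | ∀ i, X i ω ∉ ⋃ m ∈ T, small m} := by
      ext ω
      simp only [mem_iInter, mem_ofPred_eq, mem_iUnion, not_exists, D]
      exact ⟨fun h i m hm => h m hm i, fun h m hm i => h i m hm⟩
    have hvol : volume.real (⋃ m ∈ T, small m) / volume.real (cube d) =
        k * ((θ * γ * s) ^ d * ballRatio d) := by
      rw [measureReal_biUnion_finset (fun m _ l _ hml => disjoint_ball_center hd hg.le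
        (by nlinarith) (by omega)) (fun m _ => Metric.isOpen_ball.measurableSet)
        (fun m _ => (Metric.isBounded_ball.measure_lt_top).ne), Finset.sum_div,
        Finset.sum_congr rfl fun m _ => volume_real_ball_div _ hβs, Finset.sum_const, hTk,
        nsmul_eq_mul]
    rw [hset, ← hvol]
    exact measureReal_forall_notMem_le (volume_cube_ne_zero d) (volume_cube_ne_top d) hXm hXi hXu
      (T.measurableSet_biUnion fun m _ => Metric.isOpen_ball.measurableSet)
      (iUnion₂_subset fun m hm => (hsmb m).trans (hbig m (Finset.mem_range.1 (hT hm))))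
  have hDm : ∀ m, MeasurableSet (D m) := fun m => by
    have : D m = ⋂ i, X i ⁻¹' (small m)ᶜ := by ext ω; simp [D]
    rw [this]
    exact MeasurableSet.iInter fun i => hXm i Metric.isOpen_ball.measurableSet.compl
  have hB : Pr.real B ≤ (2 * (1 / (θ * γ))) ^ k *
      Real.exp (-(n * (k * ((θ * γ * s) ^ d * ballRatio d)))) := by
    set m0 := ⌈θ * γ * M⌉₊ with hm0
    have hle : θ * γ * M ≤ m0 := Nat.le_ceil _
    have h2k : 2 * k ≤ m0 := by exact_mod_cast hk.trans hle
    have h1 := measureReal_le_card_mul_choose_le (Finset.range M) hDm k m0 hD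
      (B := B) fun ω hω => hω
    rw [Finset.card_range] at h1
    have h2 : (M.choose k : ℝ) ≤ (2 * (1 / (θ * γ))) ^ k * m0.choose k := by
      refine choose_le_pow_mul_choose h2k ?_
      rw [one_div_mul_eq_div, le_div_iff₀ (by positivity)]
      linarith
    have hpos : (0 : ℝ) < m0.choose k := by
      exact_mod_cast Nat.choose_pos (by omega)
    refine le_of_mul_le_mul_right ?_ hpos
    calc Pr.real B * m0.choose k ≤ _ := h1
      _ ≤ (2 * (1 / (θ * γ))) ^ k * m0.choose k *
          Real.exp (-(n * (k * ((θ * γ * s) ^ d * ballRatio d)))) := by gcongr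
      _ = _ := by ring
  calc Pr.real {ω | ENNReal.ofReal (1 + ε) * optCost (cubeProblem d ξ) < c ω}
      ≤ Pr.real (N ∪ ((⋃ m ∈ Finset.range M, A m) ∪ B)) := measureReal_mono hsub
    _ ≤ Pr.real N + (Pr.real (⋃ m ∈ Finset.range M, A m) + Pr.real B) :=
        (measureReal_union_le _ _).trans (by gcongr; exact measureReal_union_le _ _)
    _ ≤ _ := by rw [hN, zero_add]; gcongr

end Bound

/-! ### The rate of convergence -/

section Rate

variable {d : ℕ} {ξ η : ℝ}

theorem ballRatio_pos (d : ℕ) : 0 < ballRatio d :=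
  div_pos (ENNReal.toReal_pos (Metric.measure_ball_pos volume _ one_pos).ne'
      (Metric.isBounded_ball.measure_lt_top).ne)
    (ENNReal.toReal_pos (volume_cube_ne_zero d) (volume_cube_ne_top d))

/-- The factor in front of `(log n / n) ^ (1 / d)` in the connection radius. -/
noncomputable def radiusFactor (d : ℕ) (η : ℝ) : ℝ :=
  (1 + η) * 2 * (1 / (d : ℝ)) ^ (1 / (d : ℝ)) * (1 / ballRatio d) ^ (1 / (d : ℝ))

theorem radius_eq (n : ℕ) : radius d (cubeProblem d ξ).free η n =
    radiusFactor d η * (Real.log n / n) ^ (1 / (d : ℝ)) := by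
  rw [radius, radiusFactor, ballRatio, one_div_div]
  rfl

theorem rpow_one_div_pow (hd : 0 < d) {x : ℝ} (hx : 0 ≤ x) : (x ^ (1 / (d : ℝ))) ^ d = x := by
  rw [one_div]
  exact Real.rpow_inv_natCast_pow hx hd.ne'

theorem radiusFactor_pos (hd : 0 < d) (hη : 0 < η) : 0 < radiusFactor d η := by
  have := ballRatio_pos d
  unfold radiusFactor
  positivity

/-- Thus `n` times the volume fraction of a ball of radius proportional to `r_n` is a multiple of
`log n`, and the exponential bounds become powers of `n`. -/
theorem radiusFactor_pow_mul (hd : 0 < d) :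
    radiusFactor d η ^ d * ballRatio d = ((1 + η) * 2) ^ d / d := by
  have h := ballRatio_pos d
  rw [radiusFactor, mul_pow, mul_pow, rpow_one_div_pow hd (by positivity),
    rpow_one_div_pow hd (by positivity)]
  field_simp

theorem exp_neg_mul_log {n : ℕ} (hn : 0 < n) (q : ℝ) :
    Real.exp (-(q * Real.log n)) = (n : ℝ) ^ (-q) := by
  rw [Real.rpow_def_of_pos (by exact_mod_cast hn)]
  ring_nf

theorem tendsto_log_div_rpow (hd : 0 < d) :
    Tendsto (fun n : ℕ => (Real.log n / n) ^ (1 / (d : ℝ))) atTop (nhds 0) := by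
  have h1 : Tendsto (fun n : ℕ => Real.log n / n) atTop (nhds 0) :=
    (Real.isLittleO_log_id_atTop.tendsto_div_nhds_zero).comp tendsto_natCast_atTop_atTop
  have hpos : (0 : ℝ) < 1 / d := by positivity
  have := h1.rpow_const (p := 1 / (d : ℝ)) (Or.inr hpos.le)
  rwa [Real.zero_rpow hpos.ne'] at this

/-- By continuity at `θ = 0`. The loss `ρ` in the rate pays for the positive spacing of the centers.
-/
theorem exists_pos_le_exponent (d : ℕ) (η : ℝ) {ρ : ℝ} (hρ : 0 < ρ) :
    ∃ θ : ℝ, 0 < θ ∧ θ ≤ 1 ∧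
      (1 + η) ^ d / d - ρ ≤ ((1 + η) * 2 / (2 + θ)) ^ d / d := by
  have hcont : ContinuousAt (fun θ : ℝ => ((1 + η) * 2 / (2 + θ)) ^ d / (d : ℝ)) 0 := by
    have : ContinuousAt (fun θ : ℝ => (1 + η) * 2 / (2 + θ)) 0 :=
      continuousAt_const.div (by fun_prop) (by norm_num)
    exact (this.pow d).div_const _
  have hval : (1 + η) ^ d / (d : ℝ) - ρ < ((1 + η) * 2 / (2 + 0)) ^ d / (d : ℝ) := by
    rw [add_zero, mul_div_cancel_right₀ _ two_ne_zero]
    linarith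
  have h1 := (hcont.eventually (lt_mem_nhds hval)).filter_mono
    (nhdsWithin_le_nhds (s := Ioi 0))
  have h2 : ∀ᶠ θ : ℝ in nhdsWithin 0 (Ioi 0), θ ∈ Ioo (0 : ℝ) 1 := Ioo_mem_nhdsGT one_pos
  obtain ⟨θ, h1, h2⟩ := (h1.and h2).exists
  exact ⟨θ, h2.1, h2.2.le, h1.le⟩

variable {Ω : Type*} [MeasurableSpace Ω] {Pr : Measure Ω} [IsProbabilityMeasure Pr]

/-- The order of choices matters: `θ` depends on `ρ`, `γ` on `ε`, `k` on both, and only then does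
`n` grow, so that everything but `s n` and `M` is constant. -/
theorem isBigO_measureReal_cost_gt (hd : 0 < d) (hξ : 0 < ξ) (hξd : ξ < √(d : ℝ) / 2)
    (hη : 0 < η) {X : (n : ℕ) → Fin n → Ω → EuclideanSpace ℝ (Fin d)}
    (hXm : ∀ n i, Measurable (X n i)) (hXi : ∀ n, iIndepFun (X n) Pr)
    (hXu : ∀ n i, pdf.IsUniform (X n i) (cubeProblem d ξ).free Pr volume) {c : ℕ → Ω → ℝ≥0∞}
    (hc : ∀ n ω, IsCost (cubeProblem d ξ) (fun i => X n i ω)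
      (radius d (cubeProblem d ξ).free η n) (c n ω)) {ε ρ : ℝ} (hε : 0 < ε) (hρ : 0 < ρ) :
    (fun n : ℕ => Pr.real {ω | ENNReal.ofReal (1 + ε) * optCost (cubeProblem d ξ) < c n ω})
      =O[atTop] fun n : ℕ => Real.log n ^ (-(1 / (d : ℝ))) *
        (n : ℝ) ^ (1 / (d : ℝ) * (1 - (1 + η) ^ d) + ρ) := by
  have hd1 : (1 : ℝ) ≤ d := by exact_mod_cast hd
  have hdpos : (0 : ℝ) < d := by linarith
  obtain ⟨θ, hθ, hθ1, hθq⟩ := exists_pos_le_exponent d η hρ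
  set q : ℝ := ((1 + η) * 2 / (2 + θ)) ^ d / d with hq
  have hqpos : 0 < q := by positivity
  -- The bound `1 / 2` keeps the small balls disjoint; `ε / 8` makes `1 + 4 * γ < 1 + ε`, leaving
  -- room for the overshoot at the goal.
  set γ : ℝ := min (1 / 2) (ε / 8) with hγdef
  have hγ : 0 < γ := by positivity
  have hγ1 : γ ≤ 1 / 2 := min_le_left _ _
  have hγε : 4 * γ < ε := by linarith [min_le_right (1 / 2) (ε / 8)]
  set e : ℝ := 1 / (d : ℝ) * (1 - (1 + η) ^ d) + ρ with he
  set L : ℝ := √(d : ℝ) / 2 - ξ with hL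
  have hLpos : 0 < L := by linarith
  have hβ : 0 < θ * γ := by positivity
  -- With this `k` the second term is at most a constant times `n⁻¹ * n ^ e`, and `n⁻¹` is below the
  -- logarithmic factor.
  obtain ⟨k, hk⟩ := exists_nat_ge ((1 - e) / ((θ * γ) ^ d * q))
  rw [div_le_iff₀ (by positivity)] at hk
  set b : ℝ := radiusFactor d η / (2 + θ) with hb
  have hbpos : 0 < b := div_pos (radiusFactor_pos hd hη) (by linarith)
  have hbq : b ^ d * ballRatio d = q := by
    rw [hb, div_pow, div_mul_eq_mul_div, radiusFactor_pow_mul hd, hq, div_pow]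
    field_simp
  set s : ℕ → ℝ := fun n => b * (Real.log n / n) ^ (1 / (d : ℝ)) with hs
  have hs0 : Tendsto s atTop (nhds 0) := by
    have h := (tendsto_log_div_rpow hd).const_mul b
    rwa [mul_zero] at h
  -- All smallness conditions on `s n`. The last one yields `2 * k ≤ θ * γ * M`, because `M * (θ * s
  -- n) ≥ L`.
  have hev : ∀ᶠ x in nhds (0 : ℝ), x * (√(d : ℝ) + 1 + θ) < ξ ∧
      (L + (1 + θ) * x) * (1 + 4 * γ) < (1 + ε) * L ∧ x < 1 ∧ 2 * k * x < γ * L := by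
    refine Eventually.and ?_ (Eventually.and ?_ (Eventually.and ?_ ?_))
    · exact ContinuousAt.eventually_lt (by fun_prop) continuousAt_const (by simpa using hξ)
    · refine ContinuousAt.eventually_lt (by fun_prop) continuousAt_const ?_
      nlinarith
    · exact gt_mem_nhds one_pos
    · refine ContinuousAt.eventually_lt (by fun_prop) continuousAt_const ?_
      rw [mul_zero]; positivity
  set C₁ : ℝ := (L + 1 + θ) / (θ * b) with hC₁
  set C₂ : ℝ := (2 * (1 / (θ * γ))) ^ k with hC₂
  refine IsBigO.of_bound (C₁ + C₂) ?_
  filter_upwards [hs0.eventually hev, eventually_ge_atTop 3] with n hn hn3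
  obtain ⟨hn1, hn2, hn4, hn5⟩ := hn
  have hn0 : 0 < n := by omega
  have hnR : (0 : ℝ) < n := by exact_mod_cast hn0
  have hlog : 1 ≤ Real.log n := by
    rw [Real.le_log_iff_exp_le hnR]
    have h3 : (3 : ℝ) ≤ n := by exact_mod_cast hn3
    linarith [Real.exp_one_lt_d9]
  have hlogpos : 0 < Real.log n := by linarith
  have hsn : 0 < s n := by simp only [hs]; positivity
  have hspow : n * (s n ^ d * ballRatio d) = q * Real.log n := by
    simp only [hs]
    rw [mul_pow, rpow_one_div_pow hd (by positivity), ← hbq]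
    field_simp
  have hrad : radius d (cubeProblem d ξ).free η n = (2 + θ) * s n := by
    rw [radius_eq]; simp only [hs, hb]; field_simp
  have hMlow := le_numSteps_mul (d := d) (ξ := ξ) (s := s n) (mul_pos hθ hsn)
  have hMup := (numSteps_mul_lt (d := d) (ξ := ξ) (s := s n) (mul_pos hθ hsn)
    (by linarith)).le
  set M := numSteps d ξ (θ * s n) (s n) with hM
  have hkM : 2 * (k : ℝ) ≤ θ * γ * M := by
    refine le_of_mul_le_mul_right ?_ hsn
    have : γ * L ≤ γ * (M * (θ * s n)) := by gcongr; linarith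
    linarith
  have hbound := measureReal_cost_gt_le (Pr := Pr) hd hξ hξd hθ hγ hγ1 (by nlinarith) hsn hε
    hn1.le hn2.le hkM (hXm n) (hXi n) (hXu n) (c := c n) (fun ω => hrad ▸ hc n ω)
  have hlogn : (n : ℝ)⁻¹ ≤ Real.log n ^ (-(1 / (d : ℝ))) := by
    rw [Real.rpow_neg hlogpos.le]
    refine inv_anti₀ (by positivity) ?_
    calc Real.log n ^ (1 / (d : ℝ)) ≤ Real.log n ^ (1 : ℝ) :=
          Real.rpow_le_rpow_of_exponent_le hlog (by rw [div_le_one hdpos]; exact hd1)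
      _ = Real.log n := Real.rpow_one _
      _ ≤ n := (Real.log_le_sub_one_of_pos hnR).trans (by linarith)
  have hn1' : (1 : ℝ) ≤ n := by exact_mod_cast hn0
  have hMle : (M : ℝ) ≤ C₁ * (Real.log n ^ (-(1 / (d : ℝ))) * (n : ℝ) ^ (1 / (d : ℝ))) := by
    have h1 : (Real.log n ^ (-(1 / (d : ℝ))) * (n : ℝ) ^ (1 / (d : ℝ))) * s n = b := by
      simp only [hs]
      rw [Real.div_rpow hlogpos.le hnR.le, Real.rpow_neg hlogpos.le]
      have h2 : 0 < Real.log n ^ (1 / (d : ℝ)) := by positivity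
      have h3 : 0 < (n : ℝ) ^ (1 / (d : ℝ)) := by positivity
      field_simp
    refine le_of_mul_le_mul_right ?_ (mul_pos hθ hsn)
    have h4 : θ * s n ≤ θ * 1 := mul_le_mul_of_nonneg_left hn4.le hθ.le
    calc (M : ℝ) * (θ * s n) ≤ L + 1 + θ := by linarith
      _ = C₁ * (θ * b) := by rw [hC₁]; field_simp
      _ = _ := by rw [← h1]; ring
  have hfirst : M * Real.exp (-(n * (s n ^ d * ballRatio d))) ≤
      C₁ * (Real.log n ^ (-(1 / (d : ℝ))) * (n : ℝ) ^ e) := by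
    rw [hspow, exp_neg_mul_log hn0]
    calc M * (n : ℝ) ^ (-q)
        ≤ C₁ * (Real.log n ^ (-(1 / (d : ℝ))) * (n : ℝ) ^ (1 / (d : ℝ))) * (n : ℝ) ^ (-q) := by
          gcongr
      _ = C₁ * (Real.log n ^ (-(1 / (d : ℝ))) * (n : ℝ) ^ (1 / (d : ℝ) + -q)) := by
          rw [Real.rpow_add hnR]; ring
      _ ≤ _ := by
          gcongr
          rw [he]
          have : 1 / (d : ℝ) * (1 - (1 + η) ^ d) = 1 / d - (1 + η) ^ d / d := by ring
          linarith
  have hsecond : C₂ * Real.exp (-(n * (k * ((θ * γ * s n) ^ d * ballRatio d)))) ≤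
      C₂ * (Real.log n ^ (-(1 / (d : ℝ))) * (n : ℝ) ^ e) := by
    have h1 : n * (k * ((θ * γ * s n) ^ d * ballRatio d)) =
        (k * ((θ * γ) ^ d * q)) * Real.log n := by
      rw [mul_pow]
      linear_combination (k * (θ * γ) ^ d) * hspow
    rw [h1, exp_neg_mul_log hn0]
    gcongr
    calc (n : ℝ) ^ (-(k * ((θ * γ) ^ d * q))) ≤ (n : ℝ) ^ (-1 + e) :=
          Real.rpow_le_rpow_of_exponent_le hn1' (by linarith)
      _ = (n : ℝ)⁻¹ * (n : ℝ) ^ e := by rw [Real.rpow_add hnR, Real.rpow_neg_one]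
      _ ≤ _ := by gcongr
  rw [Real.norm_of_nonneg measureReal_nonneg, Real.norm_of_nonneg (by positivity), add_mul]
  exact hbound.trans (add_le_add hfirst hsecond)

/-- The threshold is exactly where the two exponents agree: both conditions say `(1 + η) ^ d * (2 ^
d - 1) ≥ 2 ^ d`. -/
theorem half_pow_le_of_threshold_le (hd : 0 < d)
    (h : 2 / ((2 : ℝ) ^ d - 1) ^ (1 / (d : ℝ)) - 1 ≤ η) :
    ((1 + η) / 2) ^ d ≤ (1 + η) ^ d - 1 := by
  have h2 : (1 : ℝ) < 2 ^ d := one_lt_pow₀ (by norm_num) hd.ne'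
  have hpos : (0 : ℝ) < 2 ^ d - 1 := by linarith
  have h3 : 2 / ((2 : ℝ) ^ d - 1) ^ (1 / (d : ℝ)) ≤ 1 + η := by linarith
  have h4 := pow_le_pow_left₀ (by positivity) h3 d
  rw [div_pow, rpow_one_div_pow hd hpos.le, div_le_iff₀ hpos] at h4
  rw [div_pow, div_le_iff₀ (by positivity)]
  linarith

theorem isBigO_log_rpow_mul_rpow (hd : 0 < d)
    (h : 2 / ((2 : ℝ) ^ d - 1) ^ (1 / (d : ℝ)) - 1 ≤ η) (ρ : ℝ) :
    (fun n : ℕ => Real.log n ^ (-(1 / (d : ℝ))) *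
      (n : ℝ) ^ (1 / (d : ℝ) * (1 - (1 + η) ^ d) + ρ)) =O[atTop]
    fun n : ℕ => (n : ℝ) ^ (-(1 / (d : ℝ)) * ((1 + η) / 2) ^ d + ρ) := by
  refine IsBigO.of_bound 1 ?_
  filter_upwards [eventually_ge_atTop 3] with n hn3
  have h3 : (3 : ℝ) ≤ n := by exact_mod_cast hn3
  have hlog : 1 ≤ Real.log n := by
    rw [Real.le_log_iff_exp_le (by linarith)]
    linarith [Real.exp_one_lt_d9]
  have hq : (0 : ℝ) < 1 / d := by positivity
  have hle := half_pow_le_of_threshold_le hd h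
  rw [Real.norm_of_nonneg (by positivity), Real.norm_of_nonneg (by positivity)]
  refine mul_le_mul (Real.rpow_le_one_of_one_le_of_nonpos hlog (by linarith))
    (Real.rpow_le_rpow_of_exponent_le (by linarith) ?_) (by positivity) zero_le_one
  have := mul_le_mul_of_nonneg_left hle hq.le
  linarith

end Rate

end FMT

theorem theorem4 (d : ℕ) (hd : 2 ≤ d) (ξ : ℝ) (hξ : 0 < ξ) (hξd : ξ < √(d : ℝ) / 2)
    (η : ℝ) (hη : 0 < η)
    {Ω : Type*} [MeasurableSpace Ω] (Pr : Measure Ω) [IsProbabilityMeasure Pr]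
    -- for every `n`, the `n` samples, i.i.d. uniform in the cube
    (X : (n : ℕ) → Fin n → Ω → EuclideanSpace ℝ (Fin d))
    (hXmeas : ∀ n i, Measurable (X n i))
    (hXindep : ∀ n, iIndepFun (X n) Pr)
    (hXunif : ∀ n i, pdf.IsUniform (X n i) (FMT.cubeProblem d ξ).free Pr volume)
    -- the arc length `c_n` of the path returned by the algorithm, with ties broken arbitrarily
    (c : ℕ → Ω → ℝ≥0∞)
    (hc : ∀ n ω, FMT.IsCost (FMT.cubeProblem d ξ) (fun i => X n i ω)
      (FMT.radius d (FMT.cubeProblem d ξ).free η n) (c n ω)) :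
    -- the length of a shortest path
    (∃ σ, FMT.IsShortest (FMT.cubeProblem d ξ) σ) ∧
    FMT.optCost (FMT.cubeProblem d ξ) = ENNReal.ofReal (√(d : ℝ) / 2 - ξ) ∧
    -- the clearance of a shortest path, the boundary of the cube being the obstacle
    (∀ σ, FMT.IsShortest (FMT.cubeProblem d ξ) σ →
      IsGreatest {δ | FMT.StrongClearance (frontier (FMT.cube d)) δ σ} (ξ / √(d : ℝ))) ∧
    -- the convergence rate
    ∀ ε : ℝ, 0 < ε → ∀ ρ : ℝ, 0 < ρ →
      (η ≤ 2 / ((2 : ℝ) ^ d - 1) ^ (1 / (d : ℝ)) - 1 →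
        (fun n : ℕ => Pr.real
            {ω | ENNReal.ofReal (1 + ε) * FMT.optCost (FMT.cubeProblem d ξ) < c n ω})
          =O[atTop] fun n : ℕ => Real.log n ^ (-(1 / (d : ℝ))) *
            (n : ℝ) ^ (1 / (d : ℝ) * (1 - (1 + η) ^ d) + ρ)) ∧
      (2 / ((2 : ℝ) ^ d - 1) ^ (1 / (d : ℝ)) - 1 < η →
        (fun n : ℕ => Pr.real
            {ω | ENNReal.ofReal (1 + ε) * FMT.optCost (FMT.cubeProblem d ξ) < c n ω})
          =O[atTop] fun n : ℕ => (n : ℝ) ^ (-(1 / (d : ℝ)) * ((1 + η) / 2) ^ d + ρ)) ∧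
      (η = 1 →
        (fun n : ℕ => Pr.real
            {ω | ENNReal.ofReal (1 + ε) * FMT.optCost (FMT.cubeProblem d ξ) < c n ω})
          =O[atTop] fun n : ℕ => (n : ℝ) ^ (-(1 / (d : ℝ)) + ρ)) := by
  have hd0 : 0 < d := by omega
  have hrate : ∀ ε : ℝ, 0 < ε → ∀ ρ : ℝ, 0 < ρ → _ := fun ε hε ρ hρ =>
    FMT.isBigO_measureReal_cost_gt hd0 hξ hξd hη hXmeas hXindep hXunif hc hε hρ
  refine ⟨⟨_, FMT.isShortest_straightPath hd0 hξ hξd⟩, FMT.optCost_cubeProblem hd0 hξ hξd,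
    fun σ hσ => FMT.isGreatest_clearance hd0 hξ hξd hσ, fun ε hε ρ hρ =>
    ⟨fun _ => hrate ε hε ρ hρ,
      fun h => (hrate ε hε ρ hρ).trans (FMT.isBigO_log_rpow_mul_rpow hd0 h.le ρ),
      fun h => ?_⟩⟩
  subst h
  have h4 : (4 : ℝ) ≤ 2 ^ d := by
    calc (4 : ℝ) = 2 ^ 2 := by norm_num
      _ ≤ 2 ^ d := pow_le_pow_right₀ (by norm_num) hd
  have hroot : (1 : ℝ) ≤ ((2 : ℝ) ^ d - 1) ^ (1 / (d : ℝ)) :=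
    Real.one_le_rpow (by linarith) (by positivity)
  -- So `η = 1` is not below the threshold, and there `((1 + η) / 2) ^ d = 1`.
  have hthr : 2 / ((2 : ℝ) ^ d - 1) ^ (1 / (d : ℝ)) - 1 ≤ 1 := by
    have : 2 / ((2 : ℝ) ^ d - 1) ^ (1 / (d : ℝ)) ≤ 2 := div_le_self (by norm_num) hroot
    linarith
  simpa [one_add_one_eq_two] using
    (hrate ε hε ρ hρ).trans (FMT.isBigO_log_rpow_mul_rpow hd0 hthr ρ)
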